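/- Let $H$ be a positive definite hermitian form on $\mathbb C^g$ (linear in the first variable) and let $\nu>0$. Let $\Gamma=\mathbb Z\omega_1+\dots+\mathbb Z\omega_r$ be a discrete subgroup of $(\mathbb C^g,+)$ of rank $r$, with $\mathbb Z$-basis $\omega_1,\dots,\omega_r$, which is isotropic, i.e. $\operatorname{Im}H(\gamma,\gamma')=0$ for all $\gamma,\gamma'\in\Gamma$ (so that $r\le g$). Let $\omega_{r+1},\dots,\omega_g$ be an $H$-orthonormal basis of the $H$-orthogonal complement of $\operatorname{Span}_{\mathbb C}(\Gamma)$. Then $\omega_1,\dots,\omega_g$ is a basis of $\mathbb C^g$; write $u=\sum_{j}z_j\omega_j\in\mathbb C^g$ as $u=(z,z_\perp)$ with $z=(z_1,\dots,z_r)$ and $z_\perp=(z_{r+1},\dots,z_g)$, and let $d\lambda$ be the Lebesgue measure in the coordinates $z_1,\dots,z_g$. Let $B=(H(\omega_j,\omega_k))_{1\le j,k\le r}$, which is a real symmetric positive definite matrix, and $B(z,w)=\sum_{j,k=1}^r z_jw_kH(\omega_j,\omega_k)$ for $z,w\in\mathbb C^r$. Let $\chi$ be a unitary character of $\Gamma$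 and let $\alpha\in\mathbb R^r$ be such that $\chi(m_1\omega_1+\dots+m_r\omega_r)=e^{2\pi i(\alpha_1m_1+\dots+\alpha_rm_r)}$ for $m\in\mathbb Z^r$. Let $\Lambda$ be a fundamental domain of $\Gamma$ in $\mathbb C^g$, and let $\mathcal F^{2,\nu,H}_{\Gamma,\chi}(\mathbb C^g)$ be the space of all holomorphic functions $f$ on $\mathbb C^g$ with $$f(u+\gamma)=\chi(\gamma)\,e^{\nu H(u+\frac{\gamma}{2},\gamma)}f(u)\quad(u\in\mathbb C^g,\ \gamma\in\Gamma),\qquad \|f\|^2=\int_{\Lambda}|f(u)|^2e^{-\nu H(u,u)}\,d\lambda(u)<\infty,$$ with the scalar product $\langle f,h\rangle=\int_\Lambda f\,\overline{h}\,e^{-\nu H(u,u)}\,d\lambda(u)$. Then $\mathcal F^{2,\nu,H}_{\Gamma,\chi}(\mathbb C^g)$ is a reproducing kernel Hilbert space: the scalar product is positive definite, the space is complete, and the evaluations $f\mapsto f(u)$ are continuous. Its reproducing kernel $K$ (the function with $K(\cdot,v)\in\mathcal F^{2,\nu,H}_{\Gamma,\chi}(\mathbb C^g)$ and $f(v)=\langle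 f,K(\cdot,v)\rangle$ for all $f$ and all $v\in\mathbb C^g$) is given, for $u=(z,z_\perp)$ and $v=(w,w_\perp)$, by $$K(u,v)=\sqrt{\det B}\,\Big(\frac{2\nu}{\pi}\Big)^{r/2}\Big(\frac{\nu}{\pi}\Big)^{g-r}e^{\frac{\nu}{2}\left(B(z,z)+\overline{B(w,w)}\right)}\,\Theta_{\alpha,0}\Big(z-\overline w\,\Big|\,\frac{2\pi i}{\nu}B^{-1}\Big)\,e^{\nu\sum_{j=r+1}^{g}z_j\overline{w_j}},$$ where $\Theta_{\alpha,\beta}(z|F)=\sum_{n\in\mathbb Z^r}e^{2\pi i\left\{\frac12(\alpha+n)F(\alpha+n)+(\alpha+n)(z+\beta)\right\}}$ is the Riemann theta function with characteristics $\alpha,\beta$; the series converges absolutely for $\beta=0$, $F=\frac{2\pi i}{\nu}B^{-1}$ and every $z\in\mathbb C^r$. -/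

import Mathlib

open MeasureTheory Complex

noncomputable section

namespace ThetaFock

variable {g r : ℕ}

/-- A sesquilinear form on `ℂ^g`, linear in the first and conjugate-linear in the second variable. -/
abbrev SesqForm (g : ℕ) : Type := (Fin g → ℂ) →ₗ[ℂ] (Fin g → ℂ) →ₗ⋆[ℂ] ℂ

/-- `H` is a positive definite hermitian form. -/
structure IsPosDefHermitian (H : SesqForm g) : Prop where
  conj_symm : ∀ u v, starRingEnd ℂ (H v u) = H u v
  pos : ∀ u, u ≠ 0 → 0 < (H u u).re

/-- `Γ` is isotropic for the symplectic form `E = Im H`. -/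
def IsIsotropic (H : SesqForm g) (Γ : AddSubgroup (Fin g → ℂ)) : Prop :=
  ∀ u ∈ Γ, ∀ v ∈ Γ, (H u v).im = 0

/-- The vector of `ℂ^g` with coordinates `(z, z_⊥)` with respect to the vectors
`ω₁, …, ω_r` (generators of `Γ`) and `η₁, …, η_{g-r}`, that is `∑ z_j ω_j + ∑ (z_⊥)_k η_k`. -/
def coord {Γ : AddSubgroup (Fin g → ℂ)} (ω : Module.Basis (Fin r) ℤ Γ)
    (η : Fin (g - r) → Fin g → ℂ) (p : (Fin r → ℂ) × (Fin (g - r) → ℂ)) : Fin g → ℂ :=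
  ∑ j, p.1 j • (ω j : Fin g → ℂ) + ∑ k, p.2 k • η k

/-- Lebesgue measure `∏ dx_j dy_j` in the complex coordinates `(z, z_⊥)`. -/
def lebesgue {Γ : AddSubgroup (Fin g → ℂ)} (ω : Module.Basis (Fin r) ℤ Γ)
    (η : Fin (g - r) → Fin g → ℂ) : Measure (Fin g → ℂ) :=
  Measure.map (coord ω η) volume

/-- The measure `e^{-ν H(u,u)} dλ(u)` on `D`. -/
def gaussianMeasure (ν : ℝ) (H : SesqForm g) (lam : Measure (Fin g → ℂ)) (D : Set (Fin g → ℂ)) :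
    Measure (Fin g → ℂ) :=
  (lam.restrict D).withDensity fun u => ENNReal.ofReal (Real.exp (-ν * (H u u).re))

/-- The space of all holomorphic functions `f` on `ℂ^g` with
`f(u + γ) = χ(γ) e^{ν H(u + γ/2, γ)} f(u)` for `u ∈ ℂ^g` and `γ ∈ Γ`, whose restriction to `D`
lies in `L²(D; e^{-ν H(u,u)} dλ)`. -/
def thetaSpace (ν : ℝ) (H : SesqForm g) (Γ : AddSubgroup (Fin g → ℂ)) (χ : Γ → Circle)
    (lam : Measure (Fin g → ℂ)) (D : Set (Fin g → ℂ)) : Submodule ℂ ((Fin g → ℂ) → ℂ) where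
  carrier := {f | Differentiable ℂ f ∧
    (∀ (u : Fin g → ℂ) (γ : Γ), f (u + γ) =
      (χ γ : ℂ) * Complex.exp (ν * H (u + (1 / 2 : ℂ) • (γ : Fin g → ℂ)) γ) * f u) ∧
    MemLp f 2 (gaussianMeasure ν H lam D)}
  add_mem' := by
    rintro f h ⟨hf, hf', hf''⟩ ⟨hh, hh', hh''⟩
    refine ⟨hf.add hh, fun u γ => ?_, hf''.add hh''⟩
    simp only [Pi.add_apply, hf' u γ, hh' u γ, mul_add]
  zero_mem' := ⟨differentiable_const (0 : ℂ), fun u γ => by simp, MemLp.zero⟩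
  smul_mem' := by
    rintro c f ⟨hf, hf', hf''⟩
    refine ⟨hf.const_smul c, fun u γ => ?_, hf''.const_smul c⟩
    simp only [Pi.smul_apply, hf' u γ, smul_eq_mul]
    ring

/-- The scalar product of `L²(D; e^{-ν H(u,u)} dλ)` on the theta space, with Mathlib's convention
that an inner product is conjugate-linear in its first variable. -/
def thetaInner (ν : ℝ) (H : SesqForm g) (Γ : AddSubgroup (Fin g → ℂ)) (χ : Γ → Circle)
    (lam : Measure (Fin g → ℂ)) (D : Set (Fin g → ℂ)) (f h : thetaSpace ν H Γ χ lam D) : ℂ :=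
  ∫ u, starRingEnd ℂ (f.1 u) * h.1 u ∂(gaussianMeasure ν H lam D)

/-- Let `E` be a complex vector space of functions on `X`, where `ev f x` is the value of `f` at `x`.
With the scalar product `ip`, it is a reproducing kernel Hilbert space with kernel `K`: the form `ip`
is an inner product on `E`, the space is complete for the norm that `ip` induces, `ev` makes it an
`RKHS` (so that point evaluations are continuous), and `K x y` is its kernel, i.e. `K x y = k_y x`
where `k_y` is the element of `E` with `f y = ip k_y f` for all `f`. -/
def IsRKHSWithKernel {X E : Type*} [AddCommGroup E] [Module ℂ E] (ev : E →ₗ[ℂ] X → ℂ)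
    (ip : E → E → ℂ) (K : X → X → ℂ) : Prop :=
  ∃ c : InnerProductSpace.Core ℂ E, (∀ f h : E, c.inner f h = ip f h) ∧
    letI : NormedAddCommGroup E := c.toNormedAddCommGroup
    letI : InnerProductSpace ℂ E := InnerProductSpace.ofCore c.toCore
    ∃ (_ : CompleteSpace E) (_ : RKHS ℂ E X ℂ),
      (∀ (f : E) (x : X), RKHS.coeCLM ℂ f x = ev f x) ∧
      ∀ x y : X, RKHS.kernel E x y 1 = K x y

/-- The Gram matrix `B = (H(ω_j, ω_k))`. For isotropic `Γ` the numbers `H(ω_j, ω_k)` are real. -/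
def gram (H : SesqForm g) {Γ : AddSubgroup (Fin g → ℂ)} (ω : Module.Basis (Fin r) ℤ Γ) :
    Matrix (Fin r) (Fin r) ℝ :=
  Matrix.of fun j k => (H (ω j : Fin g → ℂ) (ω k : Fin g → ℂ)).re

/-- The complex bilinear form `B(z, w) = ∑ z_j w_k B_{jk}` on `ℂ^r`. -/
def bilin (B : Matrix (Fin r) (Fin r) ℝ) (z w : Fin r → ℂ) : ℂ :=
  ∑ j, ∑ k, z j * w k * (B j k : ℂ)

/-- The `n`-th term of the Riemann theta series with characteristics `α, β`:
`exp (2πi (½ (α+n) F (α+n) + (α+n) (z+β)))`. -/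
def thetaTerm (α β : Fin r → ℝ) (z : Fin r → ℂ) (F : Matrix (Fin r) (Fin r) ℂ)
    (n : Fin r → ℤ) : ℂ :=
  Complex.exp (2 * Real.pi * Complex.I *
    ((1 / 2) * (∑ j, ∑ k, ((α j : ℂ) + n j) * F j k * ((α k : ℂ) + n k)) +
      ∑ j, ((α j : ℂ) + n j) * (z j + β j)))

/-- The Riemann theta function with characteristics `α, β`. -/
def theta (α β : Fin r → ℝ) (z : Fin r → ℂ) (F : Matrix (Fin r) (Fin r) ℂ) : ℂ :=
  ∑' n : Fin r → ℤ, thetaTerm α β z F n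

/-- The matrix `(2πi/ν) B⁻¹`. -/
def periodMatrix (ν : ℝ) (B : Matrix (Fin r) (Fin r) ℝ) : Matrix (Fin r) (Fin r) ℂ :=
  (2 * Real.pi * Complex.I / ν : ℂ) • (B⁻¹).map (fun x : ℝ => (x : ℂ))

end ThetaFock

end

/-!
In the coordinates `(z, z_⊥)` the form splits as `H(u, u) = x·Bx + y·By + |z_⊥|²` with `z = x + iy`.
Multiplication by `e^{-(ν/2) B(z, z)}` turns the functional equation into quasi-periodicity,
`G (z + n, z_⊥) = e^{2πi α·n} G (z, z_⊥)` for `n ∈ ℤ^r` (`isQuasiPeriodic_reduced_iff`), and the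
weight `e^{-ν H(u, u)}` into `e^{-2ν y·By} e^{-ν |z_⊥|²}` (`conj_mul_mul_weight`). The scalar product
does not depend on the fundamental domain, so the real parts `x` may run over the unit cube.

Quasi-periodic functions have a Fourier expansion `G (z, z_⊥) = ∑ c_n(z_⊥) e^{2πi (α + n)·z}` in which
`c_n` does not depend on `y`, because the mean of a periodic entire function over a real period is an
entire function of the base point that is constant in real directions (`integral_unitBox_add_eq`).
The functions `φ_{n,w} = e^{2πi (α + n)·z} e^{ν z_⊥·\bar w}` therefore isolate these coefficients:
`⟪φ_{n,w}, G⟫ = (π/ν)^{g-r} N_n c_n(w)`, where `N_n = ∫ e^{-4π (α + n)·y - 2ν y·By} dy` is a Gaussian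
integral, proportional to `e^{(2π²/ν) (α + n)·B⁻¹(α + n)}`, and the integral over `z_⊥` is the
reproducing formula of the Fock space, that is, the mean value property
(`integral_conj_fourierFock_mul`).

Dividing by the `N_n` and summing gives the kernel: pointwise
`∑ e^{2πi (α + n)·(z - \bar w)} N_n⁻¹` is, up to a constant factor, the theta series with period matrix
`(2πi/ν) B⁻¹`. The series also converges absolutely in `L²`, because the norms of its terms are of the order
`N_n^{-1/2} |e^{2πi (α + n)·w}|` and `N_n^{-1/2}` still decays like a Gaussian
(`memLp_thetaKernel_and_hasSum`). Hence scalar products with the kernel may be taken termwise, and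
they sum the Fourier series of `G` (`integral_conj_thetaKernel_mul`); absolute convergence of this
Fourier series is a by-product.

Finally, a space of square integrable functions with a locally bounded reproducing kernel that is
closed under locally uniform limits is complete with continuous evaluations
(`isRKHSWithKernel_of_reproducing`): an `L²`-Cauchy sequence converges locally uniformly, and the
limit is again holomorphic and satisfies the functional equation.
-/

namespace ThetaFock

open Filter Topology

/-! ### Entire functions of several variables -/

section Holomorphic

variable {E : Type*} [NormedAddCommGroup E] [NormedSpace ℂ E]

/-- **Cauchy's estimate** for the Fréchet derivative of a holomorphic function on a ball. -/
lemma norm_fderiv_le_of_forall_mem_ball {f : E → ℂ} {x : E} {R C : ℝ} (hR : 0 < R)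
    (hf : DifferentiableOn ℂ f (Metric.ball x R)) (hC : ∀ y ∈ Metric.ball x R, ‖f y‖ ≤ C) :
    ‖fderiv ℂ f x‖ ≤ 2 * C / R := by
  refine Complex.norm_fderiv_le_div_of_mapsTo_ball hf (fun y hy => ?_) hR
  rw [mem_closedBall_iff_norm]
  linarith [norm_sub_le (f y) (f x), hC y hy, hC x (Metric.mem_ball_self hR)]

/-- A locally uniform limit of entire functions of several complex variables is entire: by Cauchy's
estimate the derivatives are locally uniformly Cauchy. -/
lemma differentiable_of_tendstoLocallyUniformly [ProperSpace E] {ι : Type*} {p : Filter ι}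
    [p.NeBot] {f : ι → E → ℂ} {F : E → ℂ} (hf : ∀ i, Differentiable ℂ (f i))
    (hF : TendstoLocallyUniformly f F p) : Differentiable ℂ F := by
  intro x
  have hK : TendstoUniformlyOn f F p (Metric.closedBall x 2) :=
    (tendstoLocallyUniformly_iff_forall_isCompact.1 hF) _ (isCompact_closedBall x 2)
  have hcau : UniformCauchySeqOn (fun i => fderiv ℂ (f i)) p (Metric.ball x 1) := by
    intro u hu
    obtain ⟨ε, hε, hεu⟩ := Metric.mem_uniformity_dist.1 hu
    filter_upwards [hK.uniformCauchySeqOn _ (Metric.dist_mem_uniformity (show 0 < ε / 3 by positivity))]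
      with m hm y hy
    refine hεu ?_
    have hsub : ∀ z ∈ Metric.ball y 1, ‖(f m.1 - f m.2) z‖ ≤ ε / 3 := by
      intro z hz
      have hz2 : z ∈ Metric.closedBall x 2 := by
        rw [Metric.mem_ball] at hy hz
        rw [Metric.mem_closedBall]
        linarith [dist_triangle z y x]
      have := hm z hz2
      simp only [dist_eq_norm] at this
      exact this.le
    have := norm_fderiv_le_of_forall_mem_ball one_pos
      ((hf m.1).sub (hf m.2)).differentiableOn hsub
    rw [fderiv_sub (hf m.1 y) (hf m.2 y)] at this
    rw [dist_eq_norm]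
    linarith
  have hlim : ∀ y ∈ Metric.ball x 1, ∃ L, Tendsto (fun i => fderiv ℂ (f i) y) p (𝓝 L) :=
    fun y hy => CompleteSpace.complete (hcau.cauchy_map hy)
  choose! g' hg' using hlim
  have hunif := hcau.tendstoUniformlyOn_of_tendsto hg'
  refine (hasFDerivAt_of_tendstoUniformlyOn Metric.isOpen_ball hunif
    (fun i y _ => (hf i y).hasFDerivAt) (fun y hy => ?_) (Metric.mem_ball_self one_pos)).differentiableAt
  refine hK.tendsto_at ?_
  rw [Metric.mem_ball] at hy
  rw [Metric.mem_closedBall]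
  linarith

/-- The average of translates of an entire function over a bounded family of translations is
entire. -/
lemma differentiable_integral_translate [FiniteDimensional ℂ E] {X : Type*} [MeasurableSpace X]
    [MeasurableSpace E] [BorelSpace E]
    {μ : Measure X} [IsFiniteMeasure μ] {f : E → ℂ} (hf : Differentiable ℂ f) {s : X → E}
    (hs : Measurable s) {K : Set E} (hK : IsCompact K) (hsK : ∀ᵐ a ∂μ, s a ∈ K) :
    Differentiable ℂ fun ζ => ∫ a, f (ζ + s a) ∂μ := by
  have : ProperSpace E := FiniteDimensional.proper ℂ E
  have : SecondCountableTopology E := inferInstance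
  intro ζ
  obtain ⟨C, hC⟩ := ((isCompact_closedBall ζ 2).add hK).exists_bound_of_continuousOn
    hf.continuous.continuousOn
  have hmeas : ∀ ξ, AEStronglyMeasurable (fun a => f (ξ + s a)) μ := fun ξ =>
    (hf.continuous.measurable.comp (hs.const_add ξ)).aestronglyMeasurable
  refine (hasFDerivAt_integral_of_dominated_of_fderiv_le (bound := fun _ => 2 * C / 1)
    (F' := fun ξ a => fderiv ℂ f (ξ + s a)) (Metric.ball_mem_nhds ζ one_pos)
    (Eventually.of_forall hmeas) ?_ ?_ ?_ (integrable_const _) ?_).differentiableAt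
  · refine Integrable.of_bound (hmeas ζ) C ?_
    filter_upwards [hsK] with a ha
    exact hC _ (Set.add_mem_add (Metric.mem_closedBall_self (by norm_num)) ha)
  · exact ((measurable_fderiv ℂ f).comp (hs.const_add ζ)).aestronglyMeasurable
  · filter_upwards [hsK] with a ha ξ hξ
    refine norm_fderiv_le_of_forall_mem_ball one_pos hf.differentiableOn fun y hy => hC y ?_
    refine ⟨y - s a, ?_, s a, ha, by simp⟩
    rw [Metric.mem_ball, dist_eq_norm] at hy hξ
    rw [Metric.mem_closedBall, dist_eq_norm]
    calc ‖y - s a - ζ‖ = ‖(y - (ξ + s a)) + (ξ - ζ)‖ := by congr 1; abel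
      _ ≤ 1 + 1 := (norm_add_le _ _).trans (add_le_add hy.le hξ.le)
      _ = 2 := by norm_num
  · refine Eventually.of_forall fun a ξ _ => ?_
    have h := (hf (ξ + s a)).hasFDerivAt
    simpa [Function.comp_def] using h.comp ξ ((hasFDerivAt_id ξ).add_const (s a))

end Holomorphic

/-! ### Periodic entire functions and Fourier series -/

section Periodic

variable {d : Type*}

/-- The half-open unit cube `(0, 1]^d`. -/
def unitBox (d : Type*) : Set (d → ℝ) := {x | ∀ i, x i ∈ Set.Ioc (0 : ℝ) 1}

/-- A continuous `ℤ^d`-periodic function on `ℝ^d` factors through the torus. -/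
lemma exists_torus_lift {p : (d → ℝ) → ℂ} (hp : Continuous p)
    (hper : ∀ (x : d → ℝ) (n : d → ℤ), p (x + fun i => (n i : ℝ)) = p x) :
    ∃ T : C(UnitAddTorus d, ℂ), ∀ x : d → ℝ, T (fun i => (x i : UnitAddCircle)) = p x := by
  have hq : IsOpenQuotientMap (Pi.map fun (_ : d) (t : ℝ) => (t : UnitAddCircle)) :=
    IsOpenQuotientMap.piMap fun _ => QuotientAddGroup.isOpenQuotientMap_mk
  let π : C(d → ℝ, UnitAddTorus d) := ⟨_, hq.continuous⟩
  have hπ : IsQuotientMap π := hq.isQuotientMap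
  have hfac : Function.FactorsThrough (⟨p, hp⟩ : C(d → ℝ, ℂ)) π := by
    intro x y hxy
    have hn : ∀ i, ∃ n : ℤ, x i = y i + n := by
      intro i
      have h1 : ((x i : ℝ) : UnitAddCircle) = (y i : ℝ) := congrFun hxy i
      obtain ⟨n, hn⟩ := AddSubgroup.mem_zmultiples_iff.1 (QuotientAddGroup.eq.1 h1.symm)
      exact ⟨n, by simp only [zsmul_eq_mul, mul_one] at hn; linarith⟩
    choose n hn using hn
    have : x = y + fun i => (n i : ℝ) := funext hn
    change p x = p y
    rw [this, hper]
  refine ⟨hπ.lift ⟨p, hp⟩ hfac, fun x => ?_⟩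
  exact DFunLike.congr_fun (hπ.lift_comp ⟨p, hp⟩ hfac) x

lemma integral_unitBox_translate [Fintype d] {p : (d → ℝ) → ℂ} (hp : Continuous p)
    (hper : ∀ (x : d → ℝ) (n : d → ℤ), p (x + fun i => (n i : ℝ)) = p x) (s : d → ℝ) :
    ∫ x in unitBox d, p (x + s) = ∫ x in unitBox d, p x := by
  obtain ⟨T, hT⟩ := exists_torus_lift hp hper
  -- the torus carries the product of the Haar probability measures of its factors
  let μ : Measure (UnitAddTorus d) := Measure.pi fun _ => AddCircle.haarAddCircle
  have hT' : ∀ f : UnitAddTorus d → ℂ, ∫ t, f t ∂μ = ∫ x in unitBox d, f fun i => x i := fun f => by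
    simpa only [Pi.zero_apply, zero_add] using! UnitAddTorus.integral_preimage f 0
  have h2 : ∫ t, T (t + fun i => (s i : UnitAddCircle)) ∂μ = ∫ t, T t ∂μ :=
    integral_add_right_eq_self (fun t => T t) _
  rw [hT', hT'] at h2
  have h3 : ∀ x : d → ℝ, T ((fun i => (x i : UnitAddCircle)) + fun i => (s i : UnitAddCircle))
      = p (x + s) := fun x => by rw [← hT]; rfl
  simpa only [hT, h3] using h2

lemma measurableSet_unitBox [Finite d] : MeasurableSet (unitBox d) :=
  MeasurableSet.univ_pi' fun _ => measurableSet_Ioc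

lemma unitBox_subset_Icc : unitBox d ⊆ Set.Icc 0 1 :=
  fun _ hx => ⟨fun i => (hx i).1.le, fun i => (hx i).2⟩

variable [Fintype d] {q : (d → ℂ) → ℂ}

instance isFiniteMeasure_restrict_unitBox :
    IsFiniteMeasure ((volume : Measure (d → ℝ)).restrict (unitBox d)) :=
  isFiniteMeasure_restrict.2
    ((measure_mono unitBox_subset_Icc).trans_lt isCompact_Icc.measure_lt_top).ne

/-- The mean over a period of a periodic entire function does not depend on the imaginary part: as
a function of the base point `ζ` it is entire and constant along `ℝ^d`. -/
lemma integral_unitBox_add_eq (hq : Differentiable ℂ q)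
    (hper : ∀ (z : d → ℂ) (n : d → ℤ), q (z + fun i => (n i : ℂ)) = q z) (ζ : d → ℂ) :
    ∫ x in unitBox d, q (ζ + fun i => (x i : ℂ)) = ∫ x in unitBox d, q (fun i => (x i : ℂ)) := by
  set M : (d → ℂ) → ℂ := fun ζ => ∫ x in unitBox d, q (ζ + fun i => (x i : ℂ)) with hM
  have hcast : Continuous fun x : d → ℝ => fun i => (x i : ℂ) := by fun_prop
  have hMd : Differentiable ℂ M := by
    refine differentiable_integral_translate hq (s := fun x : d → ℝ => fun i => (x i : ℂ))
      hcast.measurable ((isCompact_Icc (a := (0 : d → ℝ)) (b := 1)).image hcast) ?_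
    exact (ae_restrict_iff' measurableSet_unitBox).2
      (Eventually.of_forall fun x hx => ⟨x, unitBox_subset_Icc hx, rfl⟩)
  have hMt : ∀ (ζ : d → ℂ) (t : d → ℝ), M (ζ + fun i => (t i : ℂ)) = M ζ := by
    intro ζ t
    have h := integral_unitBox_translate (p := fun x => q (ζ + fun i => (x i : ℂ)))
      (hq.continuous.comp (continuous_const.add hcast))
      (fun x n => by
        rw [← hper (ζ + fun i => (x i : ℂ)) n]
        congr 1
        funext i
        simp [add_assoc]) t
    rw [hM]
    simp only at h ⊢
    rw [← h]
    refine integral_congr_ae (Eventually.of_forall fun x => ?_)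
    simp only
    congr 1
    funext i
    simp [add_assoc, add_comm (t i : ℂ)]
  have hreal : ∀ (ζ : d → ℂ) (t : d → ℝ), fderiv ℂ M ζ (fun i => (t i : ℂ)) = 0 := by
    intro ζ t
    have h1 : HasDerivAt (fun s : ℂ => M (ζ + s • fun i => (t i : ℂ)))
        (fderiv ℂ M ζ (fun i => (t i : ℂ))) 0 := by
      have := (hMd (ζ + (0 : ℂ) • fun i => (t i : ℂ))).hasFDerivAt.comp_hasDerivAt (0 : ℂ)
        (((hasDerivAt_id (0 : ℂ)).smul_const (fun i => (t i : ℂ))).const_add ζ)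
      simpa [Function.comp_def] using this
    have h2 : HasDerivAt (fun s : ℝ => M (ζ + (s : ℂ) • fun i => (t i : ℂ)))
        (fderiv ℂ M ζ (fun i => (t i : ℂ))) 0 := by
      have h1' : HasDerivAt (fun s : ℂ => M (ζ + s • fun i => (t i : ℂ)))
        (fderiv ℂ M ζ (fun i => (t i : ℂ))) ((0 : ℝ) : ℂ) := by simpa using h1
      exact h1'.comp_ofReal
    have h3 : (fun s : ℝ => M (ζ + (s : ℂ) • fun i => (t i : ℂ))) = fun _ => M ζ := by
      funext s
      rw [← hMt ζ (s • t)]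
      congr 2
      funext i
      simp
    rw [h3] at h2
    exact h2.unique (hasDerivAt_const _ _)
  have hzero : ∀ ζ, fderiv ℂ M ζ = 0 := by
    intro ζ
    ext v
    have hv : v = (fun i => ((v i).re : ℂ)) + I • fun i => ((v i).im : ℂ) := by
      funext i
      simp [mul_comm I, re_add_im]
    rw [hv, map_add, map_smul, hreal ζ fun i => (v i).re, hreal ζ fun i => (v i).im]
    simp
  have := is_const_of_fderiv_eq_zero hMd hzero ζ 0
  simpa [hM] using this

/-- **Fourier expansion** of a periodic entire function, under the assumption that the series
converges absolutely at the given point. -/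
lemma hasSum_fourier_of_periodic (hq : Differentiable ℂ q)
    (hper : ∀ (z : d → ℂ) (n : d → ℤ), q (z + fun i => (n i : ℂ)) = q z) {c : (d → ℤ) → ℂ}
    (hc : ∀ n, c n = ∫ x in unitBox d,
      q (fun i => (x i : ℂ)) * exp (-(2 * Real.pi * I * ∑ i, (n i : ℂ) * (x i : ℂ))))
    (w : d → ℂ)
    (hs : Summable fun n : d → ℤ => c n * exp (2 * Real.pi * I * ∑ i, (n i : ℂ) * w i)) :
    HasSum (fun n : d → ℤ => c n * exp (2 * Real.pi * I * ∑ i, (n i : ℂ) * w i)) (q w) := by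
  have hcast : Continuous fun x : d → ℝ => fun i => (x i : ℂ) := by fun_prop
  set Y : d → ℂ := I • fun i => ((w i).im : ℂ) with hY
  have hw : w = Y + fun i => ((w i).re : ℂ) := by
    funext i
    simp [hY, mul_comm I, add_comm, re_add_im]
  obtain ⟨T, hT⟩ := exists_torus_lift (p := fun x => q (Y + fun i => (x i : ℂ)))
    (hq.continuous.comp (continuous_const.add hcast))
    (fun x n => by
        rw [← hper (Y + fun i => (x i : ℂ)) n]
        congr 1
        funext i
        simp [add_assoc])
  have hF : ∀ (n : d → ℤ) (x : d → ℝ), UnitAddTorus.mFourier n (fun i => (x i : UnitAddCircle))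
      = exp (2 * Real.pi * I * ∑ i, (n i : ℂ) * (x i : ℂ)) := by
    intro n x
    simp only [UnitAddTorus.mFourier, ContinuousMap.coe_mk, fourier_coe_apply, ofReal_one, div_one]
    rw [← Complex.exp_sum, Finset.mul_sum]
    simp only [mul_assoc]
  have hcoef : ∀ n, UnitAddTorus.mFourierCoeff T n
      = c n * exp (2 * Real.pi * I * ∑ i, (n i : ℂ) * Y i) := by
    intro n
    have h1 := integral_unitBox_add_eq
      (q := fun z => q z * exp (-(2 * Real.pi * I * ∑ i, (n i : ℂ) * z i)))
      (hq.mul (by fun_prop)) (fun z m => by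
        simp only [hper, Pi.add_apply]
        congr 1
        rw [Complex.exp_eq_exp_iff_exists_int]
        refine ⟨-∑ i, n i * m i, ?_⟩
        push_cast
        simp only [mul_add, Finset.sum_add_distrib]
        ring) Y
    rw [hc n, ← h1, UnitAddTorus.mFourierCoeff_eq_integral T n 0]
    simp only [Pi.zero_apply, zero_add]
    rw [← integral_mul_const]
    refine integral_congr_ae (Eventually.of_forall fun x => ?_)
    simp only [hT, hF, smul_eq_mul]
    rw [mul_assoc (q _), ← Complex.exp_add, mul_comm]
    congr 2
    simp only [Pi.neg_apply, Int.cast_neg, neg_mul, Finset.sum_neg_distrib, Pi.add_apply, mul_add,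
      Finset.sum_add_distrib]
    ring
  have hterm : ∀ n : d → ℤ, UnitAddTorus.mFourierCoeff T n •
      UnitAddTorus.mFourier n (fun i => ((w i).re : UnitAddCircle))
      = c n * exp (2 * Real.pi * I * ∑ i, (n i : ℂ) * w i) := by
    intro n
    rw [hcoef, hF n (fun i => (w i).re), smul_eq_mul, mul_assoc, ← Complex.exp_add, ← mul_add,
      ← Finset.sum_add_distrib]
    congr 4
    funext i
    rw [← mul_add]
    congr 1
    exact (congrFun hw i).symm
  have hsum : Summable (UnitAddTorus.mFourierCoeff T) := by
    refine Summable.of_norm_bounded hs.norm fun n => ?_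
    rw [← hterm n, norm_smul, hF n (fun i => (w i).re), Complex.norm_exp]
    have : (2 * Real.pi * I * ∑ i, (n i : ℂ) * ((w i).re : ℂ)).re = 0 := by
      have : (2 * Real.pi * I * ∑ i, (n i : ℂ) * ((w i).re : ℂ))
        = ((2 * Real.pi * ∑ i, (n i : ℝ) * (w i).re : ℝ) : ℂ) * I := by
        push_cast; ring
      rw [this, re_ofReal_mul]
      simp
    rw [this]
    simp
  have := UnitAddTorus.hasSum_mFourier_series_apply_of_summable hsum
    (fun i => ((w i).re : UnitAddCircle))
  simp only [hterm] at this
  have hval : T (fun i => ((w i).re : UnitAddCircle)) = q w := by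
    rw [hT fun i => (w i).re, ← hw]
  rwa [hval] at this

end Periodic

/-! ### Gaussian integrals on complex space and the Fock reproducing formula -/

section Fock

variable {ι : Type*} [Fintype ι]

/-- The Gaussian weight `e^{-ν |ζ|²}` on `ℂ^ι`. -/
noncomputable def gaussWeight (ν : ℝ) (ζ : ι → ℂ) : ℝ := Real.exp (-ν * ∑ k, ‖ζ k‖ ^ 2)

lemma continuous_gaussWeight (ν : ℝ) : Continuous (gaussWeight ν : (ι → ℂ) → ℝ) := by
  unfold gaussWeight
  fun_prop

lemma gaussWeight_eq_prod (ν : ℝ) (ζ : ι → ℂ) :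
    gaussWeight ν ζ = ∏ k, Real.exp (-ν * ‖ζ k‖ ^ 2) := by
  rw [gaussWeight, Finset.mul_sum, Real.exp_sum]

lemma integral_exp_neg_mul_norm_sq_complex {ν : ℝ} (hν : 0 < ν) :
    ∫ z : ℂ, Real.exp (-ν * ‖z‖ ^ 2) = Real.pi / ν := by
  rw [GaussianFourier.integral_rexp_neg_mul_sq_norm hν, Complex.finrank_real_complex]
  norm_num

lemma integrable_exp_neg_mul_norm_sq_complex {ν : ℝ} (hν : 0 < ν) :
    Integrable fun z : ℂ => Real.exp (-ν * ‖z‖ ^ 2) := by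
  by_contra h
  have h1 := integral_exp_neg_mul_norm_sq_complex hν
  rw [integral_undef h] at h1
  have : 0 < Real.pi / ν := by positivity
  linarith

lemma integrable_gaussWeight {ν : ℝ} (hν : 0 < ν) :
    Integrable (gaussWeight ν : (ι → ℂ) → ℝ) := by
  simp_rw [funext fun ζ => gaussWeight_eq_prod (ι := ι) ν ζ]
  exact Integrable.fintype_prod (f := fun _ (z : ℂ) => Real.exp (-ν * ‖z‖ ^ 2))
    fun _ => integrable_exp_neg_mul_norm_sq_complex hν

lemma integral_gaussWeight {ν : ℝ} (hν : 0 < ν) :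
    ∫ ζ : ι → ℂ, gaussWeight ν ζ = (Real.pi / ν) ^ Fintype.card ι := by
  simp_rw [gaussWeight_eq_prod]
  rw [integral_fintype_prod_volume_eq_pow (fun z : ℂ => Real.exp (-ν * ‖z‖ ^ 2)),
    integral_exp_neg_mul_norm_sq_complex hν]

lemma measurePreserving_smul_of_norm_eq_one {c : ℂ} (hc : ‖c‖ = 1) :
    MeasurePreserving (fun ζ : ι → ℂ => c • ζ) volume volume := by
  have h1 : MeasurePreserving (fun z : ℂ => c * z) volume volume := by
    have := (rotation ⟨c, by simpa [Submonoid.unitSphere] using hc⟩).measurePreserving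
    exact this
  exact volume_preserving_pi (f := fun _ : ι => fun z : ℂ => c * z) fun _ => h1

/-- The Gaussian mean of an entire function is its value at the centre, since the Gaussian weight is
invariant under `ζ ↦ e^{iθ} ζ` and the means of the function over circles about `0` are `φ 0`. -/
lemma integral_mul_gaussWeight {ν : ℝ} (hν : 0 < ν) {φ : (ι → ℂ) → ℂ} (hφ : Differentiable ℂ φ)
    (hint : Integrable fun ζ => φ ζ * (gaussWeight ν ζ : ℂ)) :
    ∫ ζ, φ ζ * (gaussWeight ν ζ : ℂ) = φ 0 * ((Real.pi / ν : ℝ) : ℂ) ^ Fintype.card ι := by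
  set g : (ι → ℂ) → ℂ := fun ζ => φ ζ * (gaussWeight ν ζ : ℂ) with hg
  have hc : ∀ θ : ℝ, ‖circleMap 0 1 θ‖ = 1 := fun θ => by simp
  have hmp : ∀ θ : ℝ, MeasurePreserving (fun ζ : ι → ℂ => circleMap 0 1 θ • ζ) volume volume :=
    fun θ => measurePreserving_smul_of_norm_eq_one (hc θ)
  have hemb : ∀ θ : ℝ, MeasurableEmbedding (fun ζ : ι → ℂ => circleMap 0 1 θ • ζ) := fun θ =>
    (Homeomorph.smulOfNeZero (circleMap 0 1 θ)
      (norm_ne_zero_iff.1 (by simp))).measurableEmbedding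
  have hrot : ∀ (θ : ℝ) (ζ : ι → ℂ),
      g (circleMap 0 1 θ • ζ) = φ (circleMap 0 1 θ • ζ) * (gaussWeight ν ζ : ℂ) := by
    intro θ ζ
    simp only [hg, gaussWeight, Pi.smul_apply, norm_smul, hc, one_mul]
  have hcontg : Continuous g :=
    hφ.continuous.mul (continuous_ofReal.comp (continuous_gaussWeight ν))
  have hprod : Integrable (fun p : ℝ × (ι → ℂ) => g (circleMap 0 1 p.1 • p.2))
      ((volume.restrict (Set.Ioc 0 (2 * Real.pi))).prod volume) := by
    rw [integrable_prod_iff]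
    · refine ⟨Eventually.of_forall fun θ => ((hmp θ).integrable_comp_emb (hemb θ)).2 hint, ?_⟩
      have : (fun θ : ℝ => ∫ ζ : ι → ℂ, ‖g (circleMap 0 1 θ • ζ)‖) = fun _ => ∫ ζ, ‖g ζ‖ := by
        funext θ
        exact (hmp θ).integral_comp (hemb θ) fun ζ => ‖g ζ‖
      simp only [this]
      exact integrable_const _
    · refine Continuous.aestronglyMeasurable (hcontg.comp ?_)
      exact ((continuous_circleMap 0 1).comp continuous_fst).smul continuous_snd
  have h1 : ∫ θ in Set.Ioc 0 (2 * Real.pi), ∫ ζ, g (circleMap 0 1 θ • ζ)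
      = (2 * Real.pi : ℝ) • ∫ ζ, g ζ := by
    have : ∀ θ : ℝ, ∫ ζ, g (circleMap 0 1 θ • ζ) = ∫ ζ, g ζ := fun θ =>
      (hmp θ).integral_comp (hemb θ) g
    simp only [this]
    rw [setIntegral_const, Real.volume_real_Ioc_of_le (by positivity), sub_zero]
  have h2 : ∀ ζ, ∫ θ in Set.Ioc 0 (2 * Real.pi), g (circleMap 0 1 θ • ζ)
      = (2 * Real.pi : ℝ) • (φ 0 * (gaussWeight ν ζ : ℂ)) := by
    intro ζ
    simp only [hrot]
    rw [integral_mul_const]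
    have hav := DiffContOnCl.circleAverage (f := fun t : ℂ => φ (t • ζ)) (c := 0) (R := 1)
      (hφ.comp (differentiable_id.smul_const ζ)).diffContOnCl
    rw [Real.circleAverage, intervalIntegral.integral_of_le (by positivity),
      inv_smul_eq_iff₀ (by positivity)] at hav
    rw [hav, zero_smul, smul_mul_assoc]
  have h3 := integral_integral_swap (f := fun θ ζ => g (circleMap 0 1 θ • ζ)) hprod
  rw [h1] at h3
  simp only [h2] at h3
  rw [integral_smul] at h3
  have h4 := smul_right_injective ℂ (show (2 * Real.pi : ℝ) ≠ 0 by positivity) h3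
  rw [h4, integral_const_mul, integral_complex_ofReal, integral_gaussWeight hν]
  push_cast
  rfl

/-- The **reproducing formula of the Fock space** of `ℂ^ι`. -/
lemma integral_mul_exp_mul_gaussWeight {ν : ℝ} (hν : 0 < ν) {φ : (ι → ℂ) → ℂ}
    (hφ : Differentiable ℂ φ) (w : ι → ℂ)
    (hint : Integrable fun ζ => φ ζ * exp (ν * ∑ k, w k * starRingEnd ℂ (ζ k)) *
      (gaussWeight ν ζ : ℂ)) :
    ∫ ζ, φ ζ * exp (ν * ∑ k, w k * starRingEnd ℂ (ζ k)) * (gaussWeight ν ζ : ℂ)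
      = φ w * ((Real.pi / ν : ℝ) : ℂ) ^ Fintype.card ι := by
  -- translating the Gaussian to `w` turns the integrand into an entire function times the weight
  have hshift : ∀ ζ : ι → ℂ, φ (ζ + w) * exp (ν * ∑ k, w k * starRingEnd ℂ ((ζ + w) k)) *
      (gaussWeight ν (ζ + w) : ℂ)
      = φ (ζ + w) * exp (-(ν * ∑ k, starRingEnd ℂ (w k) * ζ k)) * (gaussWeight ν ζ : ℂ) := by
    intro ζ
    rw [mul_assoc, mul_assoc]
    congr 1
    simp only [gaussWeight, ofReal_exp]
    rw [← Complex.exp_add, ← Complex.exp_add]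
    congr 1
    push_cast
    simp only [← Complex.mul_conj', Pi.add_apply, map_add, Finset.mul_sum]
    rw [← Finset.sum_neg_distrib, ← Finset.sum_add_distrib, ← Finset.sum_add_distrib]
    refine Finset.sum_congr rfl fun k _ => ?_
    ring
  rw [← integral_add_right_eq_self _ w]
  simp only [hshift]
  rw [integral_mul_gaussWeight hν (φ := fun ζ => φ (ζ + w) *
    exp (-(ν * ∑ k, starRingEnd ℂ (w k) * ζ k)))]
  · simp
  · exact (hφ.comp (differentiable_id.add_const w)).mul (by fun_prop)
  · have := hint.comp_add_right w
    simpa only [hshift] using this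

/-- The exponential kernel functions of the Fock space are square integrable. -/
lemma integrable_norm_exp_sq_mul_gaussWeight {ν : ℝ} (hν : 0 < ν) (w : ι → ℂ) :
    Integrable fun ζ : ι → ℂ => ‖exp (ν * ∑ k, ζ k * starRingEnd ℂ (w k))‖ ^ 2 *
      gaussWeight ν ζ := by
  have h : ∀ ζ : ι → ℂ, ‖exp (ν * ∑ k, ζ k * starRingEnd ℂ (w k))‖ ^ 2 * gaussWeight ν ζ
      = Real.exp (ν * ∑ k, ‖w k‖ ^ 2) * gaussWeight ν (ζ - w) := by
    intro ζ
    rw [Complex.norm_exp, ← Real.exp_nat_mul, gaussWeight, gaussWeight, ← Real.exp_add,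
      ← Real.exp_add]
    congr 1
    rw [re_ofReal_mul, re_sum]
    simp only [Finset.mul_sum]
    rw [← Finset.sum_add_distrib, ← Finset.sum_add_distrib]
    refine Finset.sum_congr rfl fun k _ => ?_
    simp only [← Complex.normSq_eq_norm_sq, Complex.normSq_apply, Pi.sub_apply, mul_re, conj_re,
      conj_im, sub_re, sub_im]
    push_cast
    ring
  simp_rw [h]
  exact ((integrable_gaussWeight hν).comp_sub_right w).const_mul _

end Fock

/-! ### Lattice sums and Gaussian integrals for a positive definite matrix -/

section Gaussian

open Matrix

variable {ι : Type*} [Fintype ι]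

/-- A product of nonnegative summable families over the integer lattice is summable. -/
lemma summable_pi_prod {κ : Type*} {f : ι → κ → ℝ} (h0 : ∀ i k, 0 ≤ f i k)
    (hf : ∀ i, Summable (f i)) : Summable fun n : ι → κ => ∏ i, f i (n i) := by
  classical
  refine summable_of_sum_le (c := ∏ i, ∑' k, f i k)
    (fun n => Finset.prod_nonneg fun i _ => h0 i _) fun s => ?_
  calc ∑ n ∈ s, ∏ i, f i (n i)
      ≤ ∑ n ∈ Fintype.piFinset fun i => s.image fun n => n i, ∏ i, f i (n i) := by
        refine Finset.sum_le_sum_of_subset_of_nonneg (fun n hn => ?_)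
          fun n _ _ => Finset.prod_nonneg fun i _ => h0 i _
        exact Fintype.mem_piFinset.2 fun i => Finset.mem_image_of_mem (fun n => n i) hn
    _ = ∏ i, ∑ k ∈ s.image fun n => n i, f i k := (Finset.prod_univ_sum _ _).symm
    _ ≤ ∏ i, ∑' k, f i k := Finset.prod_le_prod
        (fun i _ => Finset.sum_nonneg fun k _ => h0 i k)
        fun i _ => (hf i).sum_le_tsum _ fun k _ => h0 i k

lemma summable_int_exp_neg_sq {δ : ℝ} (hδ : 0 < δ) (R α : ℝ) :
    Summable fun n : ℤ => Real.exp (-δ * (α + n) ^ 2 + R * |α + n|) := by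
  -- `(α + n)² ≥ n²/2 - α²` and `|α + n| ≤ |α| + |n|` reduce to the Jacobi theta bound
  have h := (summable_pow_mul_jacobiTheta₂_term_bound (|R| / (2 * Real.pi))
    (T := δ / (2 * Real.pi)) (by positivity) 0).mul_left (Real.exp (δ * α ^ 2 + |R| * |α|))
  refine Summable.of_nonneg_of_le (fun n => (Real.exp_pos _).le) (fun n => ?_) h
  rw [pow_zero, one_mul, ← Real.exp_add]
  refine Real.exp_le_exp.2 ?_
  have h1 : -Real.pi * (δ / (2 * Real.pi) * (n : ℝ) ^ 2 - 2 * (|R| / (2 * Real.pi)) * |(n : ℝ)|)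
      = -δ / 2 * (n : ℝ) ^ 2 + |R| * |(n : ℝ)| := by
    have := Real.pi_ne_zero
    field_simp
    ring
  rw [Int.cast_abs, h1]
  have h2 : R * |α + n| ≤ |R| * (|α| + |(n : ℝ)|) :=
    mul_le_mul (le_abs_self R) (abs_add_le _ _) (abs_nonneg _) (abs_nonneg _)
  nlinarith [mul_nonneg hδ.le (sq_nonneg (2 * α + n))]

/-- The Gaussian majorant of the theta series, for a shift of characteristic `α` and a linear term
of size `R`. -/
lemma summable_gaussian_lattice {δ : ℝ} (hδ : 0 < δ) (R : ℝ) (α : ι → ℝ) :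
    Summable fun n : ι → ℤ =>
      Real.exp (-δ * ∑ i, (α i + n i) ^ 2 + R * ∑ i, |α i + n i|) := by
  have := summable_pi_prod (f := fun (i : ι) (k : ℤ) =>
    Real.exp (-δ * (α i + k) ^ 2 + R * |α i + k|)) (fun _ _ => (Real.exp_pos _).le)
    fun i => summable_int_exp_neg_sq hδ R (α i)
  refine this.congr fun n => ?_
  rw [← Real.exp_sum, Finset.sum_add_distrib, Finset.mul_sum, Finset.mul_sum]

variable [DecidableEq ι] {B : Matrix ι ι ℝ}

open scoped MatrixOrder in
lemma exists_symm_sqrt (hB : B.PosDef) : ∃ S : Matrix ι ι ℝ, Sᵀ = S ∧ S * S = B ∧ S.det ≠ 0 := by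
  have h0 : (0 : Matrix ι ι ℝ) ≤ B := nonneg_iff_posSemidef.2 hB.posSemidef
  have hS : CFC.sqrt B * CFC.sqrt B = B := CFC.sqrt_mul_sqrt_self B h0
  have hpos : (CFC.sqrt B).PosSemidef := nonneg_iff_posSemidef.1 (CFC.sqrt_nonneg B)
  refine ⟨CFC.sqrt B, ?_, hS, fun h => ?_⟩
  · have := hpos.isHermitian
    rwa [IsHermitian, conjTranspose_eq_transpose_of_trivial] at this
  · have hdet := hB.det_pos
    rw [← hS, det_mul, h, mul_zero] at hdet
    exact hdet.false

/-- The inverse of a positive definite matrix is bounded below: expand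
`0 ≤ (B⁻¹ a - t a) ⬝ B (B⁻¹ a - t a)` for small `t`. -/
lemma exists_pos_le_inv_quadratic (hB : B.PosDef) :
    ∃ δ > 0, ∀ a : ι → ℝ, δ * ∑ i, a i ^ 2 ≤ a ⬝ᵥ B⁻¹ *ᵥ a := by
  obtain ⟨M, hM, hMB⟩ : ∃ M > 0, ∀ a : ι → ℝ, a ⬝ᵥ B *ᵥ a ≤ M * ∑ i, a i ^ 2 := by
    refine ⟨1 + ∑ i, ∑ j, |B i j|, by positivity, fun a => ?_⟩
    have hle : ∀ i, a i ^ 2 ≤ ∑ k, a k ^ 2 := fun i =>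
      Finset.single_le_sum (f := fun k => a k ^ 2) (fun k _ => sq_nonneg _) (Finset.mem_univ i)
    have hs : 0 ≤ ∑ k, a k ^ 2 := Finset.sum_nonneg fun k _ => sq_nonneg _
    have h1 : a ⬝ᵥ B *ᵥ a ≤ (∑ i, ∑ j, |B i j|) * ∑ k, a k ^ 2 := by
      simp only [dotProduct, mulVec]
      rw [Finset.sum_mul]
      refine Finset.sum_le_sum fun i _ => ?_
      rw [Finset.mul_sum, Finset.sum_mul]
      refine Finset.sum_le_sum fun j _ => ?_
      calc a i * (B i j * a j) ≤ |a i * (B i j * a j)| := le_abs_self _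
        _ = |B i j| * (|a i| * |a j|) := by rw [abs_mul, abs_mul]; ring
        _ ≤ |B i j| * ∑ k, a k ^ 2 := by
          refine mul_le_mul_of_nonneg_left ?_ (abs_nonneg _)
          have := hle i
          have := hle j
          nlinarith [sq_nonneg (|a i| - |a j|), sq_abs (a i), sq_abs (a j)]
    linarith
  refine ⟨M⁻¹, by positivity, fun a => ?_⟩
  have hBB : B *ᵥ (B⁻¹ *ᵥ a) = a := by
    rw [mulVec_mulVec, mul_nonsing_inv _ hB.det_pos.ne'.isUnit, one_mulVec]
  have hsymm : ∀ x y : ι → ℝ, x ⬝ᵥ B *ᵥ y = (B *ᵥ x) ⬝ᵥ y := by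
    intro x y
    have hBt : Bᵀ = B := by
      have := hB.isHermitian
      rwa [IsHermitian, conjTranspose_eq_transpose_of_trivial] at this
    rw [dotProduct_mulVec, ← mulVec_transpose, hBt]
  have h0 := hB.posSemidef.dotProduct_mulVec_nonneg (B⁻¹ *ᵥ a - M⁻¹ • a)
  rw [star_trivial, mulVec_sub, hBB, mulVec_smul, sub_dotProduct, dotProduct_sub, dotProduct_sub,
    smul_dotProduct, smul_dotProduct, dotProduct_smul, dotProduct_smul, hsymm (B⁻¹ *ᵥ a), hBB,
    dotProduct_comm (B⁻¹ *ᵥ a) a] at h0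
  have h1 := hMB a
  have h2 : a ⬝ᵥ a = ∑ i, a i ^ 2 := by simp [dotProduct, sq]
  rw [h2] at h0
  simp only [smul_eq_mul] at h0
  have h3 : M⁻¹ * (M⁻¹ * (a ⬝ᵥ B *ᵥ a)) ≤ M⁻¹ * ∑ i, a i ^ 2 := by
    refine mul_le_mul_of_nonneg_left ?_ (by positivity)
    rw [inv_mul_le_iff₀ hM]
    exact h1
  linarith

/-- The Gaussian density with quadratic form `c B` and linear term `b`. -/
noncomputable def gaussDensity (c : ℝ) (B : Matrix ι ι ℝ) (b y : ι → ℝ) : ℝ :=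
  Real.exp (-c * (y ⬝ᵥ B *ᵥ y) + b ⬝ᵥ y)

/-- The substitution `v = S y` with `S² = B` reduces the Gaussian integral to the standard one. -/
lemma integrable_and_integral_gaussDensity (hB : B.PosDef) {c : ℝ} (hc : 0 < c) (b : ι → ℝ) :
    Integrable (gaussDensity c B b) ∧ ∫ y, gaussDensity c B b y
      = (Real.pi / c) ^ ((Fintype.card ι : ℝ) / 2) / √B.det
        * Real.exp ((b ⬝ᵥ B⁻¹ *ᵥ b) / (4 * c)) := by
  obtain ⟨S, hSt, hSB, hdet⟩ := exists_symm_sqrt hB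
  set β : ι → ℝ := S⁻¹ *ᵥ b with hβ
  set g : (ι → ℝ) → ℝ := fun v => Real.exp (-c * ∑ i, v i ^ 2 + ∑ i, β i * v i) with hg
  have hgc : ∀ v, (g v : ℂ) = cexp (-(c : ℂ) * ∑ i, (v i : ℂ) ^ 2 + ∑ i, (β i : ℂ) * v i) := by
    intro v
    simp only [hg]
    push_cast
    rfl
  have hgint : Integrable g := by
    have h := (GaussianFourier.integrable_cexp_neg_mul_sum_add (b := (c : ℂ)) (by simpa using hc)
      fun i => (β i : ℂ)).re
    refine h.congr (Eventually.of_forall fun v => ?_)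
    simp only [← hgc]
    exact ofReal_re _
  have hgval : ∫ v, g v = (Real.pi / c) ^ ((Fintype.card ι : ℝ) / 2)
      * Real.exp ((b ⬝ᵥ B⁻¹ *ᵥ b) / (4 * c)) := by
    have h := GaussianFourier.integral_cexp_neg_mul_sum_add (b := (c : ℂ)) (by simpa using hc)
      fun i => (β i : ℂ)
    simp only [← hgc] at h
    rw [integral_complex_ofReal] at h
    have hβ2 : ∑ i, β i ^ 2 = b ⬝ᵥ B⁻¹ *ᵥ b := by
      have h1 : ∑ i, β i ^ 2 = β ⬝ᵥ β := by simp [dotProduct, sq]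
      have h2 : (S⁻¹)ᵀ = S⁻¹ := by rw [transpose_nonsing_inv, hSt]
      rw [h1, hβ, dotProduct_mulVec, ← mulVec_transpose, h2, mulVec_mulVec, ← Matrix.mul_inv_rev,
        hSB, dotProduct_comm]
    apply ofReal_injective
    rw [h, ← hβ2]
    push_cast
    rw [ofReal_cpow (by positivity)]
    push_cast
    rfl
  have hcomp : ∀ y, gaussDensity c B b y = g (toLin' S y) := by
    intro y
    simp only [gaussDensity, hg, toLin'_apply]
    congr 2
    · congr 1
      have h1 : ∑ i, (S *ᵥ y) i ^ 2 = (S *ᵥ y) ⬝ᵥ (S *ᵥ y) := by simp [dotProduct, sq]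
      rw [h1, dotProduct_mulVec (S *ᵥ y), ← mulVec_transpose, hSt, mulVec_mulVec, hSB,
        dotProduct_comm]
    · change b ⬝ᵥ y = β ⬝ᵥ S *ᵥ y
      rw [dotProduct_mulVec, ← mulVec_transpose, hSt, hβ, mulVec_mulVec,
        mul_nonsing_inv _ hdet.isUnit, one_mulVec]
  have hmap := Real.map_matrix_volume_pi_eq_smul_volume_pi hdet
  have hemb : MeasurableEmbedding (toLin' S) := by
    have hu : IsUnit S := (isUnit_iff_isUnit_det S).2 hdet.isUnit
    have hinv : Function.Injective (toLin' S) := by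
      rw [show ((toLin' S : (ι → ℝ) →ₗ[ℝ] ι → ℝ) : (ι → ℝ) → ι → ℝ) = S.mulVec from
        funext fun y => toLin'_apply S y]
      exact mulVec_injective_iff_isUnit.2 hu
    exact ((LinearMap.isClosedEmbedding_of_injective (LinearMap.ker_eq_bot.2 hinv))).measurableEmbedding
  have hfun : gaussDensity c B b = g ∘ toLin' S := funext hcomp
  have habs : |S.det⁻¹| = (√B.det)⁻¹ := by
    rw [← hSB, det_mul, Real.sqrt_mul_self_eq_abs, abs_inv]
  constructor
  · rw [hfun, ← hemb.integrable_map_iff, hmap]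
    exact hgint.smul_measure ENNReal.ofReal_ne_top
  · rw [hfun]
    simp only [Function.comp]
    rw [← hemb.integral_map, hmap, integral_smul_measure, hgval,
      ENNReal.toReal_ofReal (abs_nonneg _), habs, smul_eq_mul]
    ring

end Gaussian

/-! ### Function spaces with a reproducing kernel -/

section Kernel

open scoped InnerProductSpace

/-- If `L²` functions converge in `L²` and have representatives that converge pointwise, along the same
filter, then the two limits agree almost everywhere. -/
lemma ae_eq_of_tendsto_Lp {X : Type*} [MeasurableSpace X] {μ : Measure X} {ι : Type*}
    {p : Filter ι} [p.NeBot] [p.IsCountablyGenerated] {u : ι → Lp ℂ 2 μ}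
    {G : Lp ℂ 2 μ} (hu : Tendsto u p (𝓝 G)) {v : ι → X → ℂ} (hv : ∀ i, u i =ᵐ[μ] v i)
    {F : X → ℂ} (hF : ∀ x, Tendsto (fun i => v i x) p (𝓝 (F x))) : G =ᵐ[μ] F := by
  obtain ⟨ns, hns, hlim⟩ := (tendstoInMeasure_of_tendsto_Lp hu).exists_seq_tendsto_ae'
  filter_upwards [hlim, ae_all_iff.2 fun k => hv (ns k)] with x hx hvx
  refine tendsto_nhds_unique hx ?_
  simp only [hvx]
  exact (hF x).comp hns

variable {X : Type*} [TopologicalSpace X] [MeasurableSpace X]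

/-- A space of square integrable functions which has a locally bounded reproducing kernel and is
closed under locally uniform limits is a reproducing kernel Hilbert space. An `L²`-limit `G` of a
Cauchy sequence is represented by the function `x ↦ ⟪k x, G⟫`, the locally uniform limit of the
sequence. -/
lemma isRKHSWithKernel_of_reproducing {μ : Measure X} {S : Type*} [AddCommGroup S]
    [Module ℂ S] {ev : S →ₗ[ℂ] X → ℂ} (hinj : Function.Injective ev)
    (hS : ∀ f, MemLp (ev f) 2 μ) {ip : S → S → ℂ}
    (hip : ∀ f h : S, ip f h = ∫ u, starRingEnd ℂ (ev f u) * ev h u ∂μ) (k : X → S)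
    (hk : ∀ (f : S) (x : X), ev f x = ip (k x) f)
    (hbdd : ∀ x, ∃ C : ℝ, ∀ᶠ y in 𝓝 x, ‖ev (k y) y‖ ≤ C)
    (hclosed : ∀ (u : ℕ → S) (F : X → ℂ), TendstoLocallyUniformly (fun n => ev (u n)) F atTop →
      MemLp F 2 μ → ∃ f, ev f = F) :
    IsRKHSWithKernel ev ip fun x y => ev (k y) x := by
  let ι : S →ₗ[ℂ] Lp ℂ 2 μ :=
    { toFun := fun f => (hS f).toLp (ev f)
      map_add' := fun f h => by
        rw [← MemLp.toLp_add (hS f) (hS h)]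
        exact MemLp.toLp_congr _ _ (by rw [map_add])
      map_smul' := fun a f => by
        rw [RingHom.id_apply, ← MemLp.toLp_const_smul a (hS f)]
        exact MemLp.toLp_congr _ _ (by rw [map_smul]) }
  have hι : ∀ f : S, ι f =ᵐ[μ] ev f := fun f => MemLp.coeFn_toLp (hS f)
  have hinner : ∀ f h : S, ⟪ι f, ι h⟫_ℂ = ip f h := by
    intro f h
    rw [hip, L2.inner_def]
    refine integral_congr_ae ?_
    filter_upwards [hι f, hι h] with u hf hh
    rw [hf, hh, RCLike.inner_apply, mul_comm]
  have hev : ∀ (f : S) (x : X), ev f x = ⟪ι (k x), ι f⟫_ℂ := fun f x => by rw [hinner, ← hk]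
  let c : InnerProductSpace.Core ℂ S :=
    { inner := fun f h => ⟪ι f, ι h⟫_ℂ
      conj_inner_symm := fun f h => inner_conj_symm _ _
      re_inner_nonneg := fun f => inner_self_nonneg
      add_left := fun f h l => by rw [map_add, inner_add_left]
      smul_left := fun f h a => by rw [map_smul, inner_smul_left]
      definite := fun f hf => by
        refine hinj (funext fun x => ?_)
        rw [map_zero, hev f x, inner_self_eq_zero.1 hf, inner_zero_right]
        rfl }
  refine ⟨c, hinner, ?_⟩
  let _ : NormedAddCommGroup S := c.toNormedAddCommGroup
  let _ : InnerProductSpace ℂ S := InnerProductSpace.ofCore c.toCore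
  have hcin : ∀ f h : S, ⟪f, h⟫_ℂ = ⟪ι f, ι h⟫_ℂ := fun _ _ => rfl
  have hnorm : ∀ f : S, ‖f‖ = ‖ι f‖ := fun f => by
    rw [norm_eq_sqrt_re_inner (𝕜 := ℂ) f, norm_eq_sqrt_re_inner (𝕜 := ℂ) (ι f), hcin]
  have hcomplete : CompleteSpace S := by
    refine Metric.complete_of_cauchySeq_tendsto fun u hu => ?_
    have hcau : CauchySeq fun n => ι (u n) := by
      rw [Metric.cauchySeq_iff] at hu ⊢
      intro ε hε
      obtain ⟨N, hN⟩ := hu ε hε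
      refine ⟨N, fun m hm n hn => ?_⟩
      have := hN m hm n hn
      rwa [dist_eq_norm, hnorm, map_sub, ← dist_eq_norm] at this
    obtain ⟨G, hG⟩ := cauchySeq_tendsto_of_complete hcau
    have hnorm0 : Tendsto (fun n => ‖ι (u n) - G‖) atTop (𝓝 0) :=
      tendsto_iff_norm_sub_tendsto_zero.1 hG
    set F : X → ℂ := fun x => ⟪ι (k x), G⟫_ℂ with hF
    have hle : ∀ n x, ‖F x - ev (u n) x‖ ≤ ‖ι (k x)‖ * ‖ι (u n) - G‖ := by
      intro n x
      rw [hev, hF, ← inner_sub_right, norm_sub_rev (ι (u n))]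
      exact norm_inner_le_norm _ _
    have hunif : TendstoLocallyUniformly (fun n => ev (u n)) F atTop := by
      rw [Metric.tendstoLocallyUniformly_iff]
      intro ε hε x
      obtain ⟨C, hC⟩ := hbdd x
      refine ⟨_, hC, ?_⟩
      have hlim : Tendsto (fun n => √C * ‖ι (u n) - G‖) atTop (𝓝 0) := by
        simpa using hnorm0.const_mul √C
      filter_upwards [hlim.eventually (gt_mem_nhds hε)] with n hn y hy
      rw [dist_eq_norm]
      refine ((hle n y).trans ?_).trans_lt hn
      refine mul_le_mul_of_nonneg_right ?_ (norm_nonneg _)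
      refine Real.le_sqrt_of_sq_le ?_
      have h1 : ‖ev (k y) y‖ = ‖ι (k y)‖ ^ 2 := by
        rw [hev, inner_self_eq_norm_sq_to_K]
        simp
      rw [← h1]
      exact hy
    have hpt : ∀ x, Tendsto (fun n => ev (u n) x) atTop (𝓝 (F x)) := fun x =>
      (tendstoLocallyUniformlyOn_univ.2 hunif).tendsto_at (Set.mem_univ x)
    have hGF : G =ᵐ[μ] F := ae_eq_of_tendsto_Lp hG (fun n => hι (u n)) hpt
    have hFL : MemLp F 2 μ := (memLp_congr_ae hGF).1 (Lp.memLp G)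
    obtain ⟨f, hf⟩ := hclosed u F hunif hFL
    refine ⟨f, ?_⟩
    have hFG : ι f = G := Lp.ext (((hι f).trans (by rw [hf])).trans hGF.symm)
    rw [tendsto_iff_norm_sub_tendsto_zero]
    simpa only [hnorm, map_sub, hFG] using hnorm0
  have hcont : Continuous ev := by
    refine continuous_pi fun x => ?_
    have : (fun f : S => ev f x) = fun f : S => ⟪k x, f⟫_ℂ := funext fun f => hev f x
    rw [this]
    exact continuous_const.inner continuous_id
  let rk : RKHS ℂ S X ℂ :=
    { coeCLM := ⟨ev, hcont⟩
      coeCLM_injective := hinj }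
  refine ⟨hcomplete, rk, fun f x => rfl, fun x y => ?_⟩
  have hker : RKHS.kerFun S y 1 = k y := by
    refine ext_inner_right ℂ fun f => ?_
    rw [RKHS.kerFun_inner, hcin, ← hev, RCLike.inner_apply, map_one, mul_one]
    rfl
  rw [← RKHS.kerFun_apply, hker]
  rfl

end Kernel

/-! ### Coordinates and fundamental domains -/

section Coordinates

open Matrix

variable {g r : ℕ} {H : SesqForm g} {Γ : AddSubgroup (Fin g → ℂ)} {ω : Module.Basis (Fin r) ℤ Γ}
  {η : Fin (g - r) → Fin g → ℂ}

lemma apply_basis_eq_gram (hΓ : IsIsotropic H Γ) (j k : Fin r) :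
    H (ω j : Fin g → ℂ) (ω k : Fin g → ℂ) = (gram H ω j k : ℂ) := by
  apply Complex.ext
  · rfl
  · rw [ofReal_im]
    exact hΓ _ (ω j).2 _ (ω k).2

/-- The hermitian form in the coordinates `(z, z_⊥)`. -/
lemma apply_coord (hH : IsPosDefHermitian H) (hΓ : IsIsotropic H Γ)
    (hη : ∀ j k, H (η j) (η k) = if j = k then 1 else 0)
    (hηω : ∀ k j, H (η k) (ω j : Fin g → ℂ) = 0) (p q : (Fin r → ℂ) × (Fin (g - r) → ℂ)) :
    H (coord ω η p) (coord ω η q) =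
      ∑ j, ∑ k, p.1 j * starRingEnd ℂ (q.1 k) * (gram H ω j k : ℂ)
        + ∑ k, p.2 k * starRingEnd ℂ (q.2 k) := by
  have hωη : ∀ j k, H (ω j : Fin g → ℂ) (η k) = 0 := fun j k => by
    rw [← hH.conj_symm, hηω, map_zero]
  simp only [coord, map_add, map_sum, map_smul, LinearMap.map_smulₛₗ, LinearMap.add_apply,
    LinearMap.sum_apply, LinearMap.smul_apply, hωη, hηω, hη, apply_basis_eq_gram hΓ, smul_eq_mul,
    mul_zero, Finset.sum_const_zero, add_zero, zero_add, mul_ite, mul_one, Finset.mul_sum]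
  congr 1
  · rw [Finset.sum_comm]
    refine Finset.sum_congr rfl fun j _ => Finset.sum_congr rfl fun k _ => ?_
    ring
  · simp [mul_comm]

/-- `H(u, u)` in terms of the real and imaginary parts of the coordinates of `u`. -/
lemma apply_coord_self_re (hH : IsPosDefHermitian H) (hΓ : IsIsotropic H Γ)
    (hη : ∀ j k, H (η j) (η k) = if j = k then 1 else 0)
    (hηω : ∀ k j, H (η k) (ω j : Fin g → ℂ) = 0) (p : (Fin r → ℂ) × (Fin (g - r) → ℂ)) :
    (H (coord ω η p) (coord ω η p)).re =
      (fun j => (p.1 j).re) ⬝ᵥ gram H ω *ᵥ (fun j => (p.1 j).re)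
        + (fun j => (p.1 j).im) ⬝ᵥ gram H ω *ᵥ (fun j => (p.1 j).im) + ∑ k, ‖p.2 k‖ ^ 2 := by
  rw [apply_coord hH hΓ hη hηω, add_re]
  congr 1
  · simp only [dotProduct, mulVec, Finset.mul_sum]
    rw [← Finset.sum_add_distrib, re_sum]
    refine Finset.sum_congr rfl fun j _ => ?_
    rw [← Finset.sum_add_distrib, re_sum]
    refine Finset.sum_congr rfl fun k _ => ?_
    rw [re_mul_ofReal]
    simp only [mul_re, conj_re, conj_im]
    ring
  · rw [re_sum]
    refine Finset.sum_congr rfl fun k _ => ?_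
    rw [Complex.mul_conj']
    norm_cast

/-- The basis of a discrete subgroup is linearly independent over `ℝ`. -/
lemma linearIndependent_real_of_discrete [DiscreteTopology Γ] (ω : Module.Basis (Fin r) ℤ Γ) :
    LinearIndependent ℝ fun j => (ω j : Fin g → ℂ) := by
  set b : Fin r → Fin g → ℂ := fun j => (ω j : Fin g → ℂ) with hb
  have hZ : LinearIndependent ℤ b :=
    ω.linearIndependent.map' (AddSubgroup.toIntSubmodule Γ).subtype (Submodule.ker_subtype _)
  have hspan : Submodule.span ℤ (Set.range b) = AddSubgroup.toIntSubmodule Γ := by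
    refine le_antisymm (Submodule.span_le.2 ?_) fun x hx => ?_
    · rintro _ ⟨j, rfl⟩
      exact (ω j).2
    · have h : (∑ j, ω.repr ⟨x, hx⟩ j • ω j : Γ) = x :=
        congrArg (Subtype.val : Γ → Fin g → ℂ) (ω.sum_repr ⟨x, hx⟩)
      rw [← h, AddSubgroup.val_finsetSum]
      exact Submodule.sum_mem _ fun j _ =>
        Submodule.smul_mem _ _ (Submodule.subset_span (Set.mem_range_self j))
  have hdisc : DiscreteTopology (Submodule.span ℤ (Set.range b)) := by
    rw [hspan]
    exact inferInstanceAs (DiscreteTopology Γ)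
  rw [linearIndependent_iff_card_eq_finrank_span, Real.finrank_eq_int_finrank_of_discrete hdisc,
    Set.finrank, finrank_span_eq_card hZ]

/-- `coord` as a linear map. -/
noncomputable def coordLinear (ω : Module.Basis (Fin r) ℤ Γ) (η : Fin (g - r) → Fin g → ℂ) :
    ((Fin r → ℂ) × (Fin (g - r) → ℂ)) →ₗ[ℂ] Fin g → ℂ where
  toFun := coord ω η
  map_add' p q := by
    simp only [coord, Prod.fst_add, Prod.snd_add, Pi.add_apply, add_smul, Finset.sum_add_distrib]
    abel
  map_smul' a p := by
    simp only [coord, Prod.smul_fst, Prod.smul_snd, Pi.smul_apply, smul_eq_mul, mul_smul,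
      RingHom.id_apply, smul_add, Finset.smul_sum]

lemma posDef_gram [DiscreteTopology Γ] (hH : IsPosDefHermitian H) (hΓ : IsIsotropic H Γ)
    (hη : ∀ j k, H (η j) (η k) = if j = k then 1 else 0)
    (hηω : ∀ k j, H (η k) (ω j : Fin g → ℂ) = 0) : (gram H ω).PosDef := by
  refine PosDef.of_dotProduct_mulVec_pos ?_ fun x hx => ?_
  · ext j k
    rw [conjTranspose_apply, star_trivial]
    change (H (ω k : Fin g → ℂ) (ω j : Fin g → ℂ)).re = (H (ω j : Fin g → ℂ) (ω k : Fin g → ℂ)).re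
    rw [← hH.conj_symm (ω j : Fin g → ℂ), conj_re]
  · have h := apply_coord_self_re hH hΓ hη hηω ((fun j => (x j : ℂ)), 0)
    simp only [ofReal_re, ofReal_im, Pi.zero_apply, norm_zero, ne_eq, OfNat.ofNat_ne_zero,
      not_false_eq_true, zero_pow, Finset.sum_const_zero, add_zero] at h
    have hz : (fun _ : Fin r => (0 : ℝ)) ⬝ᵥ gram H ω *ᵥ (fun _ : Fin r => (0 : ℝ)) = 0 :=
      zero_dotProduct _
    rw [hz, add_zero] at h
    rw [star_trivial, ← h]
    refine hH.pos _ fun h0 => hx ?_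
    have hsum : ∑ j, x j • (ω j : Fin g → ℂ) = 0 := by
      rw [← h0]
      simp [coord, Complex.coe_smul]
    exact funext (Fintype.linearIndependent_iff.1 (linearIndependent_real_of_discrete ω) x hsum)

lemma coord_injective [DiscreteTopology Γ] (hH : IsPosDefHermitian H) (hΓ : IsIsotropic H Γ)
    (hη : ∀ j k, H (η j) (η k) = if j = k then 1 else 0)
    (hηω : ∀ k j, H (η k) (ω j : Fin g → ℂ) = 0) : Function.Injective (coord ω η) := by
  have hB := posDef_gram (ω := ω) hH hΓ hη hηω
  refine (injective_iff_map_eq_zero (coordLinear ω η)).2 fun p hp => ?_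
  have h := apply_coord_self_re hH hΓ hη hηω p
  rw [show coord ω η p = 0 from hp, map_zero, zero_re] at h
  have h1 := hB.posSemidef.dotProduct_mulVec_nonneg fun j => (p.1 j).re
  have h2 := hB.posSemidef.dotProduct_mulVec_nonneg fun j => (p.1 j).im
  have h3 : 0 ≤ ∑ k, ‖p.2 k‖ ^ 2 := Finset.sum_nonneg fun _ _ => sq_nonneg _
  rw [star_trivial] at h1 h2
  have hre : (fun j => (p.1 j).re) = 0 := by
    by_contra hne
    have := hB.dotProduct_mulVec_pos hne
    rw [star_trivial] at this
    linarith
  have him : (fun j => (p.1 j).im) = 0 := by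
    by_contra hne
    have := hB.dotProduct_mulVec_pos hne
    rw [star_trivial] at this
    linarith
  refine Prod.ext (funext fun j => Complex.ext (congrFun hre j) (congrFun him j)) ?_
  have h4 : ∑ k, ‖p.2 k‖ ^ 2 = 0 := by linarith
  funext k
  have := (Finset.sum_eq_zero_iff_of_nonneg fun k _ => sq_nonneg ‖p.2 k‖).1 h4 k (Finset.mem_univ k)
  simpa using this

lemma coord_bijective [DiscreteTopology Γ] (hH : IsPosDefHermitian H) (hΓ : IsIsotropic H Γ)
    (hη : ∀ j k, H (η j) (η k) = if j = k then 1 else 0)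
    (hηω : ∀ k j, H (η k) (ω j : Fin g → ℂ) = 0) : Function.Bijective (coord ω η) := by
  have hinj := coord_injective (ω := ω) hH hΓ hη hηω
  have hle := LinearMap.finrank_le_finrank_of_injective (f := coordLinear ω η) hinj
  have hdim : Module.finrank ℂ ((Fin r → ℂ) × (Fin (g - r) → ℂ)) = Module.finrank ℂ (Fin g → ℂ) := by
    simp only [Module.finrank_prod, Module.finrank_fin_fun] at hle ⊢
    omega
  exact ⟨hinj, (LinearMap.injective_iff_surjective_of_finrank_eq_finrank (f := coordLinear ω η) hdim).1 hinj⟩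

/-- `coord` as a continuous linear equivalence. -/
noncomputable def coordEquiv (hbij : Function.Bijective (coord ω η)) :
    ((Fin r → ℂ) × (Fin (g - r) → ℂ)) ≃L[ℂ] (Fin g → ℂ) :=
  (LinearEquiv.ofBijective (coordLinear ω η) hbij).toContinuousLinearEquiv

lemma coordEquiv_apply (hbij : Function.Bijective (coord ω η))
    (p : (Fin r → ℂ) × (Fin (g - r) → ℂ)) : coordEquiv hbij p = coord ω η p := rfl

lemma coord_eq_coordEquiv (hbij : Function.Bijective (coord ω η)) :
    coord ω η = coordEquiv hbij := rfl

lemma coord_repr (ω : Module.Basis (Fin r) ℤ Γ) (η : Fin (g - r) → Fin g → ℂ) (γ : Γ) :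
    coord ω η ((fun j => (ω.repr γ j : ℂ)), 0) = γ := by
  have h := congrArg (Subtype.val : Γ → Fin g → ℂ) (ω.sum_repr γ)
  rw [← h]
  rw [AddSubgroup.val_finsetSum]
  simp only [coord, Pi.zero_apply, zero_smul, Finset.sum_const_zero, add_zero]
  refine Finset.sum_congr rfl fun j _ => ?_
  rw [Int.cast_smul_eq_zsmul]
  rfl

lemma coord_add (p q : (Fin r → ℂ) × (Fin (g - r) → ℂ)) :
    coord ω η (p + q) = coord ω η p + coord ω η q := (coordLinear ω η).map_add p q

/-- The fundamental domain of `Γ` in which the real parts of `z` run over the unit cube. -/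
def cubeDomain (hbij : Function.Bijective (coord ω η)) : Set (Fin g → ℂ) :=
  {u | (fun j => (((coordEquiv hbij).symm u).1 j).re) ∈ unitBox (Fin r)}

lemma isAddHaarMeasure_lebesgue (hbij : Function.Bijective (coord ω η)) :
    (lebesgue ω η).IsAddHaarMeasure := by
  have : (volume : Measure ((Fin r → ℂ) × (Fin (g - r) → ℂ))).IsAddHaarMeasure := by
    exact Measure.prod.instIsAddHaarMeasure _ _
  rw [lebesgue, coord_eq_coordEquiv hbij]
  exact (coordEquiv hbij).isAddHaarMeasure_map volume

lemma measurableSet_cubeDomain (hbij : Function.Bijective (coord ω η)) :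
    MeasurableSet (cubeDomain hbij) := by
  have h : Measurable fun u => fun j => (((coordEquiv hbij).symm u).1 j).re := by
    have : Continuous fun u => fun j => (((coordEquiv hbij).symm u).1 j).re := by fun_prop
    exact this.measurable
  exact h measurableSet_unitBox

lemma isAddFundamentalDomain_cubeDomain (hbij : Function.Bijective (coord ω η)) :
    IsAddFundamentalDomain Γ (cubeDomain hbij) (lebesgue ω η) := by
  refine IsAddFundamentalDomain.mk' (measurableSet_cubeDomain hbij).nullMeasurableSet fun u => ?_
  obtain ⟨p, rfl⟩ := hbij.2 u
  have hmem : ∀ γ : Γ, γ +ᵥ coord ω η p ∈ cubeDomain hbij ↔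
      ∀ j, (p.1 j).re + ω.repr γ j ∈ Set.Ioc (0 : ℝ) 1 := by
    intro γ
    have h1 : γ +ᵥ coord ω η p
        = coordEquiv hbij (((fun j => (ω.repr γ j : ℂ)), 0) + p) := by
      rw [coordEquiv_apply, coord_add, coord_repr]
      rfl
    rw [h1]
    simp [cubeDomain, unitBox, add_comm]
  have huniq : ∀ j, ∃! n : ℤ, (p.1 j).re + n ∈ Set.Ioc (0 : ℝ) 1 := fun j => by
    simpa using existsUnique_add_zsmul_mem_Ioc one_pos (p.1 j).re 0
  choose n hn hnu using fun j => (huniq j)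
  refine ⟨ω.equivFun.symm n, (hmem _).2 fun j => ?_, fun γ hγ => ?_⟩
  · have : ω.repr (ω.equivFun.symm n) j = n j := by
      rw [← ω.equivFun_apply, LinearEquiv.apply_symm_apply]
    rw [this]
    exact hn j
  · apply ω.equivFun.injective
    rw [LinearEquiv.apply_symm_apply]
    funext j
    rw [ω.equivFun_apply]
    exact hnu j _ ((hmem γ).1 hγ j)

/-- The parametrisation of `ℂ^g` by `((x, y), z_⊥)` with `z = x + i y`. -/
noncomputable def realCoord {d e : Type*} (q : ((d → ℝ) × (d → ℝ)) × (e → ℂ)) :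
    (d → ℂ) × (e → ℂ) :=
  (fun j => (q.1.1 j : ℂ) + q.1.2 j * I, q.2)

/-- The product of Lebesgue measures with `x` restricted to the unit cube. -/
noncomputable def cubeMeasure (d e : Type*) [Fintype d] [Fintype e] :
    Measure (((d → ℝ) × (d → ℝ)) × (e → ℂ)) :=
  (((volume : Measure (d → ℝ)).restrict (unitBox d)).prod volume).prod volume

/-- `realCoord` as a measurable equivalence. -/
noncomputable def realCoordEquiv (d e : Type*) :
    ((d → ℝ) × (d → ℝ)) × (e → ℂ) ≃ᵐ (d → ℂ) × (e → ℂ) :=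
  ((MeasurableEquiv.arrowProdEquivProdArrow ℝ ℝ d).symm.trans
    (MeasurableEquiv.piCongrRight fun _ => Complex.measurableEquivRealProd.symm)).prodCongr
    (MeasurableEquiv.refl _)

lemma realCoordEquiv_apply {d e : Type*} (q : ((d → ℝ) × (d → ℝ)) × (e → ℂ)) :
    realCoordEquiv d e q = realCoord q := by
  refine Prod.ext (funext fun j => ?_) rfl
  exact Complex.mk_eq_add_mul_I _ _

lemma measurePreserving_realCoord {d e : Type*} [Fintype d] [Fintype e] :
    MeasurePreserving (realCoordEquiv d e) volume volume := by
  have h1 : MeasurePreserving ((MeasurableEquiv.arrowProdEquivProdArrow ℝ ℝ d).symm.trans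
      (MeasurableEquiv.piCongrRight fun _ => Complex.measurableEquivRealProd.symm))
      volume volume :=
    ((volume_measurePreserving_arrowProdEquivProdArrow ℝ ℝ d).symm).trans
      (volume_preserving_pi fun _ => Complex.volume_preserving_equiv_real_prod.symm)
  exact h1.prod (MeasurePreserving.id _)

lemma measurableEmbedding_coord_realCoord (hbij : Function.Bijective (coord ω η)) :
    MeasurableEmbedding fun q => coord ω η (realCoord q) := by
  have h : (fun q => coord ω η (realCoord q))
      = fun q => (coordEquiv hbij).toHomeomorph.toMeasurableEquiv (realCoordEquiv _ _ q) := by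
    funext q
    rw [realCoordEquiv_apply]
    rfl
  rw [h]
  exact ((coordEquiv hbij).toHomeomorph.toMeasurableEquiv.measurableEmbedding).comp
    (realCoordEquiv _ _).measurableEmbedding

lemma measurePreserving_coord_realCoord (hbij : Function.Bijective (coord ω η)) :
    MeasurePreserving (fun q => coord ω η (realCoord q)) (cubeMeasure (Fin r) (Fin (g - r)))
      ((lebesgue ω η).restrict (cubeDomain hbij)) := by
  have hcont : Continuous (coord ω η) := (coordEquiv hbij).continuous
  have h1 : MeasurePreserving (coord ω η) volume (lebesgue ω η) := ⟨hcont.measurable, rfl⟩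
  have h2 : MeasurePreserving (fun q => coord ω η (realCoord q)) volume (lebesgue ω η) := by
    have := h1.comp (measurePreserving_realCoord (d := Fin r) (e := Fin (g - r)))
    simpa only [Function.comp_def, realCoordEquiv_apply] using this
  have h3 := h2.restrict_preimage (measurableSet_cubeDomain hbij)
  have hpre : (fun q => coord ω η (realCoord q)) ⁻¹' cubeDomain hbij
      = (unitBox (Fin r) ×ˢ Set.univ) ×ˢ Set.univ := by
    ext q
    have : (coordEquiv hbij).symm (coord ω η (realCoord q)) = realCoord q :=
      (coordEquiv hbij).symm_apply_apply _
    rw [Set.mem_preimage, cubeDomain, Set.mem_ofPred_eq, this]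
    simp [realCoord]
  rw [hpre] at h3
  have hμ : cubeMeasure (Fin r) (Fin (g - r))
      = volume.restrict ((unitBox (Fin r) ×ˢ Set.univ) ×ˢ Set.univ) := by
    rw [cubeMeasure, Measure.volume_eq_prod, Measure.volume_eq_prod, ← Measure.prod_restrict,
      ← Measure.prod_restrict, Measure.restrict_univ, Measure.restrict_univ]
  rw [hμ]
  exact h3

variable {E : Type*} [NormedAddCommGroup E] {D : Set (Fin g → ℂ)}

/-- Integration of a `Γ`-invariant function over a fundamental domain, in coordinates. -/
lemma integrableOn_fundamentalDomain_iff
    (hbij : Function.Bijective (coord ω η))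
    (hD : IsAddFundamentalDomain Γ D (lebesgue ω η)) {f : (Fin g → ℂ) → E}
    (hf : ∀ (γ : Γ) u, f (u + γ) = f u) :
    IntegrableOn f D (lebesgue ω η) ↔
      Integrable (fun q => f (coord ω η (realCoord q))) (cubeMeasure (Fin r) (Fin (g - r))) := by
  have : Countable Γ := ω.equivFun.injective.countable
  have := isAddHaarMeasure_lebesgue hbij
  have : VAddInvariantMeasure Γ (Fin g → ℂ) (lebesgue ω η) := inferInstance
  rw [hD.integrableOn_iff (isAddFundamentalDomain_cubeDomain hbij) fun γ u => by
    rw [← hf γ u, add_comm]; rfl]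
  exact ((measurePreserving_coord_realCoord hbij).integrable_comp_emb
    (measurableEmbedding_coord_realCoord hbij)).symm

lemma setIntegral_fundamentalDomain [NormedSpace ℝ E]
    (hbij : Function.Bijective (coord ω η))
    (hD : IsAddFundamentalDomain Γ D (lebesgue ω η)) {f : (Fin g → ℂ) → E}
    (hf : ∀ (γ : Γ) u, f (u + γ) = f u) :
    ∫ u in D, f u ∂(lebesgue ω η) =
      ∫ q, f (coord ω η (realCoord q)) ∂(cubeMeasure (Fin r) (Fin (g - r))) := by
  have : Countable Γ := ω.equivFun.injective.countable
  have := isAddHaarMeasure_lebesgue hbij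
  have : VAddInvariantMeasure Γ (Fin g → ℂ) (lebesgue ω η) := inferInstance
  rw [hD.setIntegral_eq (isAddFundamentalDomain_cubeDomain hbij) fun γ u => by
    rw [← hf γ u, add_comm]; rfl]
  exact ((measurePreserving_coord_realCoord hbij).integral_comp
    (measurableEmbedding_coord_realCoord hbij) f).symm

end Coordinates

/-! ### Quasi-periodic entire functions -/

section QuasiPeriodic

open Matrix

variable {d e : Type*} [Fintype d]

/-- `e^{2πi (α + n)·z}`. -/
noncomputable def character (α : d → ℝ) (n : d → ℤ) (z : d → ℂ) : ℂ :=
  exp (2 * Real.pi * I * ∑ j, ((α j : ℂ) + n j) * z j)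

/-- `e^{ν z · \bar w}`, up to a constant the reproducing kernel of the Fock space of `ℂ^e`. -/
noncomputable def fockKernel [Fintype e] (ν : ℝ) (z w : e → ℂ) : ℂ :=
  exp (ν * ∑ k, z k * starRingEnd ℂ (w k))

/-- An entire function of `(z, z_⊥)` with `G (z + n, z_⊥) = e^{2πi α·n} G (z, z_⊥)` for `n ∈ ℤ^d`. -/
structure IsQuasiPeriodic (α : d → ℝ) (G : (d → ℂ) × (e → ℂ) → ℂ) : Prop where
  differentiable : Differentiable ℂ G
  add_int : ∀ p (n : d → ℤ), G (p + ((fun j => (n j : ℂ)), 0)) =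
    exp (2 * Real.pi * I * ∑ j, (α j : ℂ) * n j) * G p

lemma differentiable_character (α : d → ℝ) (n : d → ℤ) : Differentiable ℂ (character α n) := by
  unfold character
  fun_prop

lemma differentiable_fockKernel [Fintype e] (ν : ℝ) (w : e → ℂ) :
    Differentiable ℂ fun z => fockKernel ν z w := by
  unfold fockKernel
  fun_prop

lemma character_ne_zero (α : d → ℝ) (n : d → ℤ) (z : d → ℂ) : character α n z ≠ 0 := exp_ne_zero _

lemma character_zero_add (α : d → ℝ) (n : d → ℤ) (z : d → ℂ) :
    character α n z = character α 0 z * exp (2 * Real.pi * I * ∑ j, (n j : ℂ) * z j) := by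
  rw [character, character, ← Complex.exp_add, ← mul_add, ← Finset.sum_add_distrib]
  simp [add_mul]

lemma character_add_int (α : d → ℝ) (n m : d → ℤ) (z : d → ℂ) :
    character α n (z + fun j => (m j : ℂ))
      = exp (2 * Real.pi * I * ∑ j, (α j : ℂ) * m j) * character α n z := by
  rw [character, character, ← Complex.exp_add, Complex.exp_eq_exp_iff_exists_int]
  refine ⟨∑ j, n j * m j, ?_⟩
  push_cast
  simp only [Pi.add_apply, mul_add, add_mul, Finset.sum_add_distrib]
  ring

/-- Complex conjugation of a character, with the decay factor that its imaginary part produces. -/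
lemma conj_character (α : d → ℝ) (n : d → ℤ) (z : d → ℂ) :
    starRingEnd ℂ (character α n z) = (character α n z)⁻¹ *
      (Real.exp (-(4 * Real.pi) * ∑ j, (α j + n j) * (z j).im) : ℂ) := by
  rw [character, ← Complex.exp_conj, ← Complex.exp_neg, ofReal_exp, ← Complex.exp_add]
  congr 1
  push_cast
  simp only [map_mul, map_sum, map_add, conj_ofReal, map_intCast, conj_I, map_ofNat, Finset.mul_sum]
  rw [← Finset.sum_neg_distrib, ← Finset.sum_add_distrib]
  refine Finset.sum_congr rfl fun j _ => ?_
  have h : starRingEnd ℂ (z j) = z j - 2 * (z j).im * I := by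
    apply Complex.ext <;> simp
    ring
  rw [h]
  linear_combination (4 * Real.pi * (α j + n j) * (z j).im) * I_sq

lemma IsQuasiPeriodic.div_character_add_int {α : d → ℝ}
    {G : (d → ℂ) × (e → ℂ) → ℂ} (hG : IsQuasiPeriodic α G) (n : d → ℤ) (w : e → ℂ) (z : d → ℂ)
    (m : d → ℤ) : G (z + (fun j => (m j : ℂ)), w) * (character α n (z + fun j => (m j : ℂ)))⁻¹
      = G (z, w) * (character α n z)⁻¹ := by
  have h := hG.add_int (z, w) m
  simp only [Prod.mk_add_mk, add_zero] at h
  rw [h, character_add_int, mul_inv]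
  have := exp_ne_zero (2 * Real.pi * I * ∑ j, (α j : ℂ) * m j)
  field_simp

variable [Fintype e]

namespace IsQuasiPeriodic

variable {α : d → ℝ} {G : (d → ℂ) × (e → ℂ) → ℂ}

lemma differentiable_fst (hG : IsQuasiPeriodic α G) (w : e → ℂ) :
    Differentiable ℂ fun z => G (z, w) :=
  hG.differentiable.comp (differentiable_id.prodMk (differentiable_const w))

lemma differentiable_snd (hG : IsQuasiPeriodic α G) (z : d → ℂ) :
    Differentiable ℂ fun w => G (z, w) :=
  hG.differentiable.comp ((differentiable_const z).prodMk differentiable_id)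

lemma differentiable_div_character (hG : IsQuasiPeriodic α G) (n : d → ℤ) (w : e → ℂ) :
    Differentiable ℂ fun z => G (z, w) * (character α n z)⁻¹ :=
  (hG.differentiable_fst w).mul ((differentiable_character α n).inv (character_ne_zero α n))

end IsQuasiPeriodic

/-- The Fourier coefficients, as functions of `z_⊥`, of a quasi-periodic entire function. -/
noncomputable def fourierCoefficient (α : d → ℝ) (G : (d → ℂ) × (e → ℂ) → ℂ) (n : d → ℤ)
    (w : e → ℂ) : ℂ :=
  ∫ x in unitBox d, G ((fun j => (x j : ℂ)), w) * (character α n fun j => (x j : ℂ))⁻¹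

/-- A quasi-periodic entire function is the sum of its Fourier series wherever the latter converges
absolutely. -/
lemma IsQuasiPeriodic.hasSum {α : d → ℝ} {G : (d → ℂ) × (e → ℂ) → ℂ} (hG : IsQuasiPeriodic α G)
    (z : d → ℂ) (w : e → ℂ)
    (hs : Summable fun n => fourierCoefficient α G n w * character α n z) :
    HasSum (fun n => fourierCoefficient α G n w * character α n z) (G (z, w)) := by
  have hne := character_ne_zero α 0 z
  have hterm : ∀ n, fourierCoefficient α G n w * character α n z * (character α 0 z)⁻¹
      = fourierCoefficient α G n w * exp (2 * Real.pi * I * ∑ i, (n i : ℂ) * z i) := by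
    intro n
    rw [character_zero_add α n]
    field_simp
  have h := hasSum_fourier_of_periodic (q := fun z => G (z, w) * (character α 0 z)⁻¹)
    (hG.differentiable_div_character 0 w) (hG.div_character_add_int 0 w)
    (c := fun n => fourierCoefficient α G n w) (fun n => by
      rw [fourierCoefficient]
      refine integral_congr_ae (Eventually.of_forall fun x => ?_)
      simp only
      rw [character_zero_add α n, mul_inv, ← Complex.exp_neg, ← mul_assoc]) z
    ((hs.mul_right _).congr hterm)
  have h2 := h.mul_right (character α 0 z)
  simp only [← hterm] at h2
  simpa [mul_assoc, hne] using h2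

/-- The Gaussian weight `e^{-4π (α + n)·y - 2ν y·By}`. -/
noncomputable def fibreDensity (ν : ℝ) (B : Matrix d d ℝ) (α : d → ℝ) (n : d → ℤ) (y : d → ℝ) : ℝ :=
  Real.exp (-(4 * Real.pi) * ∑ j, (α j + n j) * y j) * Real.exp (-(2 * ν) * (y ⬝ᵥ B *ᵥ y))

lemma fibreDensity_eq (ν : ℝ) (B : Matrix d d ℝ) (α : d → ℝ) (n : d → ℤ) :
    fibreDensity ν B α n = gaussDensity (2 * ν) B ((-(4 * Real.pi)) • fun j => α j + n j) := by
  funext y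
  rw [fibreDensity, gaussDensity, ← Real.exp_add, smul_dotProduct, smul_eq_mul, add_comm]
  rfl

variable [DecidableEq d]

/-- The value of `∫ e^{-4π (α + n)·y - 2ν y·By} dy`. -/
noncomputable def gaussConst (ν : ℝ) (B : Matrix d d ℝ) (α : d → ℝ) (n : d → ℤ) : ℝ :=
  (Real.pi / (2 * ν)) ^ ((Fintype.card d : ℝ) / 2) / √B.det *
    Real.exp (2 * Real.pi ^ 2 / ν *
      ((fun j => α j + n j) ⬝ᵥ B⁻¹ *ᵥ fun j => α j + n j))

variable {ν : ℝ} {B : Matrix d d ℝ}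

lemma integrable_fibreDensity (hν : 0 < ν) (hB : B.PosDef) (α : d → ℝ) (n : d → ℤ) :
    Integrable (fibreDensity ν B α n) := by
  rw [fibreDensity_eq]
  exact (integrable_and_integral_gaussDensity hB (by positivity) _).1

lemma integral_fibreDensity (hν : 0 < ν) (hB : B.PosDef) (α : d → ℝ) (n : d → ℤ) :
    ∫ y, fibreDensity ν B α n y = gaussConst ν B α n := by
  rw [fibreDensity_eq, (integrable_and_integral_gaussDensity hB (by positivity) _).2, gaussConst]
  congr 2
  rw [mulVec_smul, smul_dotProduct, dotProduct_smul]
  simp only [smul_eq_mul]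
  field_simp
  ring

/-- The scalar product of a quasi-periodic function with `e^{2πi (α + n)·z} e^{ν z_⊥ · \bar w}`
isolates the `n`-th Fourier coefficient at `w`. The integral over `z_⊥` is the reproducing formula of
the Fock space, the one over `x` gives the Fourier coefficient, which does not depend on `y`, and the
one over `y` is Gaussian. -/
lemma IsQuasiPeriodic.integral_cubeMeasure {α : d → ℝ} {G : (d → ℂ) × (e → ℂ) → ℂ}
    (hG : IsQuasiPeriodic α G) (hν : 0 < ν) (hB : B.PosDef) (n : d → ℤ) (w : e → ℂ)
    (hint : Integrable (fun q : ((d → ℝ) × (d → ℝ)) × (e → ℂ) =>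
      G (realCoord q) * (character α n (realCoord q).1)⁻¹ * fockKernel ν w q.2 *
        (gaussWeight ν q.2 : ℂ) * (fibreDensity ν B α n q.1.2 : ℂ)) (cubeMeasure d e)) :
    ∫ q : ((d → ℝ) × (d → ℝ)) × (e → ℂ),
      G (realCoord q) * (character α n (realCoord q).1)⁻¹ * fockKernel ν w q.2 *
        (gaussWeight ν q.2 : ℂ) * (fibreDensity ν B α n q.1.2 : ℂ) ∂(cubeMeasure d e)
      = ((Real.pi / ν : ℝ) : ℂ) ^ Fintype.card e * (gaussConst ν B α n : ℂ)
        * fourierCoefficient α G n w := by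
  set Z : (d → ℝ) × (d → ℝ) → d → ℂ := fun s j => (s.1 j : ℂ) + s.2 j * I with hZ
  set P : ℂ := ((Real.pi / ν : ℝ) : ℂ) ^ Fintype.card e with hP
  have hDne : ∀ y, (fibreDensity ν B α n y : ℂ) ≠ 0 := fun y => by
    unfold fibreDensity
    exact_mod_cast (mul_pos (Real.exp_pos _) (Real.exp_pos _)).ne'
  have hinner : ∀ᵐ s ∂((volume : Measure (d → ℝ)).restrict (unitBox d)).prod volume,
      ∫ ζ : e → ℂ, G (Z s, ζ) * (character α n (Z s))⁻¹ * fockKernel ν w ζ *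
        (gaussWeight ν ζ : ℂ) * (fibreDensity ν B α n s.2 : ℂ)
      = P * ((fibreDensity ν B α n s.2 : ℂ) * (G (Z s, w) * (character α n (Z s))⁻¹)) := by
    filter_upwards [hint.prod_right_ae] with s hs
    rw [integral_mul_const]
    have hs' : Integrable fun ζ : e → ℂ => G (Z s, ζ) * (character α n (Z s))⁻¹ *
        fockKernel ν w ζ * (gaussWeight ν ζ : ℂ) := by
      have := hs.mul_const (fibreDensity ν B α n s.2 : ℂ)⁻¹
      refine this.congr (Eventually.of_forall fun ζ => ?_)
      simp only
      rw [mul_assoc _ _ (_⁻¹), mul_inv_cancel₀ (hDne s.2), mul_one]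
      rfl
    have h := integral_mul_exp_mul_gaussWeight hν (φ := fun ζ => G (Z s, ζ) * (character α n (Z s))⁻¹)
      ((hG.differentiable_snd (Z s)).mul_const _) w hs'
    rw [show (∫ ζ : e → ℂ, G (Z s, ζ) * (character α n (Z s))⁻¹ * fockKernel ν w ζ *
        (gaussWeight ν ζ : ℂ)) = _ from h]
    ring
  have hint2 : Integrable (fun s : (d → ℝ) × (d → ℝ) =>
      P * ((fibreDensity ν B α n s.2 : ℂ) * (G (Z s, w) * (character α n (Z s))⁻¹)))
      (((volume : Measure (d → ℝ)).restrict (unitBox d)).prod volume) :=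
    hint.integral_prod_left.congr hinner
  rw [cubeMeasure, integral_prod _ hint]
  refine (integral_congr_ae hinner).trans ?_
  rw [integral_prod_symm _ hint2]
  have hx : ∀ y : d → ℝ, ∫ x in unitBox d, P * ((fibreDensity ν B α n y : ℂ) *
      (G (Z (x, y), w) * (character α n (Z (x, y)))⁻¹))
      = (fibreDensity ν B α n y : ℂ) * (P * fourierCoefficient α G n w) := by
    intro y
    have h := integral_unitBox_add_eq (hG.differentiable_div_character n w)
      (hG.div_character_add_int n w) (fun j => (y j : ℂ) * I)
    have hZ' : ∀ x : d → ℝ, Z (x, y) = (fun j => (y j : ℂ) * I) + fun j => (x j : ℂ) := fun x => by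
      funext j
      simp [hZ, add_comm]
    rw [integral_const_mul, integral_const_mul]
    simp only [hZ']
    rw [h, fourierCoefficient]
    ring
  simp only [hx]
  rw [integral_mul_const, integral_complex_ofReal, integral_fibreDensity hν hB]
  ring

/-- Integrability, and the integral, of the weighted square of
`e^{2πi (α + n)·z} e^{ν z_⊥ · \bar w}`. -/
lemma integrable_and_integral_cubeMeasure (hν : 0 < ν) (hB : B.PosDef) (α : d → ℝ) (n : d → ℤ)
    (w : e → ℂ) :
    Integrable (fun q : ((d → ℝ) × (d → ℝ)) × (e → ℂ) =>
      fibreDensity ν B α n q.1.2 * (‖fockKernel ν q.2 w‖ ^ 2 * gaussWeight ν q.2))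
      (cubeMeasure d e) ∧
    ∫ q : ((d → ℝ) × (d → ℝ)) × (e → ℂ),
      fibreDensity ν B α n q.1.2 * (‖fockKernel ν q.2 w‖ ^ 2 * gaussWeight ν q.2)
        ∂(cubeMeasure d e)
      = volume.real (unitBox d) * gaussConst ν B α n *
        ∫ ζ : e → ℂ, ‖fockKernel ν ζ w‖ ^ 2 * gaussWeight ν ζ := by
  have h1 : Integrable (fun s : (d → ℝ) × (d → ℝ) => (1 : ℝ) * fibreDensity ν B α n s.2)
      (((volume : Measure (d → ℝ)).restrict (unitBox d)).prod volume) :=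
    (integrable_const (1 : ℝ)).mul_prod (integrable_fibreDensity hν hB α n)
  have h2 := integral_prod_mul (μ := (volume : Measure (d → ℝ)).restrict (unitBox d))
    (ν := (volume : Measure (d → ℝ))) (fun _ => (1 : ℝ)) (fibreDensity ν B α n)
  simp only [one_mul] at h1 h2
  refine ⟨h1.mul_prod (integrable_norm_exp_sq_mul_gaussWeight hν w), ?_⟩
  rw [cubeMeasure, integral_prod_mul (fun s : (d → ℝ) × (d → ℝ) => fibreDensity ν B α n s.2)
    (fun ζ : e → ℂ => ‖fockKernel ν ζ w‖ ^ 2 * gaussWeight ν ζ), h2, integral_fibreDensity hν hB]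
  simp

end QuasiPeriodic

/-! ### The theta series -/

section Theta

open Matrix

variable {r : ℕ} {B : Matrix (Fin r) (Fin r) ℝ} {ν : ℝ}

/-- The Gaussian factor `e^{-c (α + n)·B⁻¹(α + n)}`. -/
noncomputable def dualGauss (c : ℝ) (B : Matrix (Fin r) (Fin r) ℝ) (α : Fin r → ℝ) (n : Fin r → ℤ) :
    ℝ :=
  Real.exp (-c * ((fun j => α j + n j) ⬝ᵥ B⁻¹ *ᵥ fun j => α j + n j))

lemma dualGauss_pos (c : ℝ) (B : Matrix (Fin r) (Fin r) ℝ) (α : Fin r → ℝ) (n : Fin r → ℤ) :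
    0 < dualGauss c B α n := Real.exp_pos _

lemma thetaTerm_eq (ν : ℝ) (B : Matrix (Fin r) (Fin r) ℝ) (α : Fin r → ℝ) (z : Fin r → ℂ)
    (n : Fin r → ℤ) : thetaTerm α 0 z (periodMatrix ν B) n
      = (dualGauss (2 * Real.pi ^ 2 / ν) B α n : ℂ) * character α n z := by
  rw [thetaTerm, dualGauss, character, ofReal_exp, ← Complex.exp_add, mul_add]
  congr 2
  · simp only [periodMatrix, dotProduct, mulVec, Matrix.smul_apply, map_apply, smul_eq_mul]
    push_cast
    simp only [Finset.mul_sum]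
    refine Finset.sum_congr rfl fun j _ => Finset.sum_congr rfl fun k _ => ?_
    linear_combination (2 * Real.pi ^ 2 / ν * (α j + n j) * (B⁻¹ j k : ℂ) * (α k + n k)) * I_sq
  · simp

lemma norm_character (α : Fin r → ℝ) (n : Fin r → ℤ) (z : Fin r → ℂ) :
    ‖character α n z‖ = Real.exp (-(2 * Real.pi) * ∑ j, (α j + n j) * (z j).im) := by
  rw [character, Complex.norm_exp]
  congr 1
  have h : (2 * Real.pi * I * ∑ j, ((α j : ℂ) + n j) * z j)
      = ((2 * Real.pi : ℝ) : ℂ) * (I * ∑ j, ((α j : ℂ) + n j) * z j) := by push_cast; ring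
  rw [h, re_ofReal_mul, I_mul_re, im_sum]
  simp

lemma norm_character_le {R : ℝ} (α : Fin r → ℝ) (n : Fin r → ℤ) {z : Fin r → ℂ}
    (hz : ∀ j, |(z j).im| ≤ R) :
    ‖character α n z‖ ≤ Real.exp (2 * Real.pi * R * ∑ j, |α j + n j|) := by
  rw [norm_character]
  refine Real.exp_le_exp.2 ?_
  rw [neg_mul, ← mul_neg, ← Finset.sum_neg_distrib, mul_assoc (2 * Real.pi), Finset.mul_sum _ _ R]
  refine mul_le_mul_of_nonneg_left (Finset.sum_le_sum fun j _ => ?_) Real.two_pi_pos.le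
  calc -((α j + n j) * (z j).im) ≤ |(α j + n j) * (z j).im| := neg_le_abs _
    _ = |(z j).im| * |α j + n j| := by rw [abs_mul, mul_comm]
    _ ≤ R * |α j + n j| := mul_le_mul_of_nonneg_right (hz j) (abs_nonneg _)

lemma summable_dualGauss_mul_exp (hB : B.PosDef) {c : ℝ} (hc : 0 < c) (R : ℝ) (α : Fin r → ℝ) :
    Summable fun n : Fin r → ℤ =>
      dualGauss c B α n * Real.exp (2 * Real.pi * R * ∑ j, |α j + n j|) := by
  obtain ⟨δ, hδ, hle⟩ := exists_pos_le_inv_quadratic hB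
  refine Summable.of_nonneg_of_le (fun n => mul_nonneg (Real.exp_pos _).le (Real.exp_pos _).le)
    (fun n => ?_) (summable_gaussian_lattice (mul_pos hc hδ) (2 * Real.pi * R) α)
  rw [dualGauss, ← Real.exp_add]
  refine Real.exp_le_exp.2 ?_
  have := mul_le_mul_of_nonneg_left (hle fun j => α j + n j) hc.le
  linarith

lemma summable_dualGauss_mul_norm_character (hB : B.PosDef) {c : ℝ} (hc : 0 < c) (α : Fin r → ℝ)
    (z : Fin r → ℂ) : Summable fun n : Fin r → ℤ => dualGauss c B α n * ‖character α n z‖ :=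
  Summable.of_nonneg_of_le (fun _ => mul_nonneg (Real.exp_pos _).le (norm_nonneg _))
    (fun n => mul_le_mul_of_nonneg_left
      (norm_character_le α n fun j => (abs_im_le_norm _).trans (norm_le_pi_norm z j))
      (Real.exp_pos _).le)
    (summable_dualGauss_mul_exp hB hc ‖z‖ α)

lemma summable_thetaTerm (hν : 0 < ν) (hB : B.PosDef) (α : Fin r → ℝ) (z : Fin r → ℂ) :
    Summable (thetaTerm α 0 z (periodMatrix ν B)) := by
  refine Summable.of_norm ?_
  simp only [funext (thetaTerm_eq ν B α z), norm_mul, norm_real]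
  refine (summable_dualGauss_mul_norm_character hB (c := 2 * Real.pi ^ 2 / ν) (by positivity) α
    z).congr fun n => ?_
  rw [Real.norm_of_nonneg (dualGauss_pos _ _ _ _).le]

/-- The theta series converges locally uniformly in `z`. -/
lemma differentiable_theta (hν : 0 < ν) (hB : B.PosDef) (α : Fin r → ℝ) :
    Differentiable ℂ fun z => theta α 0 z (periodMatrix ν B) := by
  refine differentiable_of_tendstoLocallyUniformly (p := atTop)
    (f := fun (s : Finset (Fin r → ℤ)) z => ∑ n ∈ s, thetaTerm α 0 z (periodMatrix ν B) n)
    (fun s => ?_) ?_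
  · simp only [thetaTerm_eq]
    exact Differentiable.fun_sum fun n _ => (differentiable_character α n).const_mul _
  · rw [tendstoLocallyUniformly_iff_forall_isCompact]
    intro K hK
    obtain ⟨R, hR⟩ := hK.isBounded.exists_norm_le
    refine tendstoUniformlyOn_tsum (summable_dualGauss_mul_exp hB
      (c := 2 * Real.pi ^ 2 / ν) (by positivity) R α) fun n z hz => ?_
    rw [thetaTerm_eq, norm_mul, norm_real, Real.norm_of_nonneg (dualGauss_pos _ _ _ _).le]
    exact mul_le_mul_of_nonneg_left (norm_character_le α n fun j =>
      ((abs_im_le_norm _).trans (norm_le_pi_norm z j)).trans (hR z hz)) (Real.exp_pos _).le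

lemma theta_add_int (ν : ℝ) (B : Matrix (Fin r) (Fin r) ℝ) (α : Fin r → ℝ) (z : Fin r → ℂ)
    (m : Fin r → ℤ) : theta α 0 (z + fun j => (m j : ℂ)) (periodMatrix ν B)
      = exp (2 * Real.pi * I * ∑ j, (α j : ℂ) * m j) * theta α 0 z (periodMatrix ν B) := by
  rw [theta, theta, ← tsum_mul_left]
  refine tsum_congr fun n => ?_
  rw [thetaTerm_eq, thetaTerm_eq, character_add_int]
  ring

lemma gaussConst_eq (ν : ℝ) (B : Matrix (Fin r) (Fin r) ℝ) (α : Fin r → ℝ) (n : Fin r → ℤ) :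
    gaussConst ν B α n = (Real.pi / (2 * ν)) ^ ((r : ℝ) / 2) / √B.det *
      (dualGauss (2 * Real.pi ^ 2 / ν) B α n)⁻¹ := by
  rw [gaussConst, dualGauss, ← Real.exp_neg, Fintype.card_fin]
  congr 2
  ring

lemma dualGauss_mul_self (c : ℝ) (B : Matrix (Fin r) (Fin r) ℝ) (α : Fin r → ℝ) (n : Fin r → ℤ) :
    dualGauss c B α n * dualGauss c B α n = dualGauss (2 * c) B α n := by
  rw [dualGauss, dualGauss, ← Real.exp_add]
  congr 1
  ring

end Theta

/-! ### Trivialisation of the functional equation -/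

section Reduction

open Matrix

variable {g r : ℕ} {H : SesqForm g} {Γ : AddSubgroup (Fin g → ℂ)} {ω : Module.Basis (Fin r) ℤ Γ}
  {η : Fin (g - r) → Fin g → ℂ} {ν : ℝ}

/-- The trivialisation `G (z, z_⊥) = e^{-(ν/2) B(z, z)} f (z, z_⊥)`, which turns the functional
equation of theta functions into quasi-periodicity. -/
noncomputable def reduced (ν : ℝ) (H : SesqForm g) (ω : Module.Basis (Fin r) ℤ Γ)
    (η : Fin (g - r) → Fin g → ℂ) (f : (Fin g → ℂ) → ℂ) (p : (Fin r → ℂ) × (Fin (g - r) → ℂ)) : ℂ :=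
  exp (-(ν / 2 * bilin (gram H ω) p.1 p.1)) * f (coord ω η p)

/-- The inverse of `reduced`. -/
noncomputable def unreduced (ν : ℝ) (H : SesqForm g) (hbij : Function.Bijective (coord ω η))
    (G : (Fin r → ℂ) × (Fin (g - r) → ℂ) → ℂ) (u : Fin g → ℂ) : ℂ :=
  exp (ν / 2 * bilin (gram H ω) ((coordEquiv hbij).symm u).1 ((coordEquiv hbij).symm u).1) *
    G ((coordEquiv hbij).symm u)

lemma differentiable_bilin (B : Matrix (Fin r) (Fin r) ℝ) :
    Differentiable ℂ fun z : Fin r → ℂ => bilin B z z := by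
  unfold bilin
  fun_prop

lemma unreduced_coord (hbij : Function.Bijective (coord ω η))
    (G : (Fin r → ℂ) × (Fin (g - r) → ℂ) → ℂ) (p : (Fin r → ℂ) × (Fin (g - r) → ℂ)) :
    unreduced ν H hbij G (coord ω η p) = exp (ν / 2 * bilin (gram H ω) p.1 p.1) * G p := by
  have : (coordEquiv hbij).symm (coord ω η p) = p := (coordEquiv hbij).symm_apply_apply p
  rw [unreduced, this]

lemma coord_eq_exp_mul_reduced (f : (Fin g → ℂ) → ℂ) (p : (Fin r → ℂ) × (Fin (g - r) → ℂ)) :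
    f (coord ω η p) = exp (ν / 2 * bilin (gram H ω) p.1 p.1) * reduced ν H ω η f p := by
  rw [reduced, ← mul_assoc, ← Complex.exp_add, add_neg_cancel, Complex.exp_zero, one_mul]

lemma reduced_unreduced (hbij : Function.Bijective (coord ω η))
    (G : (Fin r → ℂ) × (Fin (g - r) → ℂ) → ℂ) : reduced ν H ω η (unreduced ν H hbij G) = G := by
  funext p
  rw [reduced, unreduced_coord, ← mul_assoc, ← Complex.exp_add, neg_add_cancel, Complex.exp_zero,
    one_mul]

lemma differentiable_unreduced (hbij : Function.Bijective (coord ω η))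
    {G : (Fin r → ℂ) × (Fin (g - r) → ℂ) → ℂ} (hG : Differentiable ℂ G) :
    Differentiable ℂ (unreduced ν H hbij G) := by
  have hL : Differentiable ℂ (coordEquiv hbij).symm := (coordEquiv hbij).symm.differentiable
  have h1 : Differentiable ℂ fun p : (Fin r → ℂ) × (Fin (g - r) → ℂ) =>
      exp (ν / 2 * bilin (gram H ω) p.1 p.1) :=
    (((differentiable_bilin (gram H ω)).comp differentiable_fst).const_mul _).cexp
  exact (h1.mul hG).comp hL

lemma differentiable_reduced (hbij : Function.Bijective (coord ω η))
    {f : (Fin g → ℂ) → ℂ} (hf : Differentiable ℂ f) :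
    Differentiable ℂ (reduced ν H ω η f) := by
  have hL : Differentiable ℂ (coord ω η) := (coordEquiv hbij).differentiable
  have h1 : Differentiable ℂ fun p : (Fin r → ℂ) × (Fin (g - r) → ℂ) =>
      exp (-(ν / 2 * bilin (gram H ω) p.1 p.1)) :=
    (((differentiable_bilin (gram H ω)).comp differentiable_fst).const_mul _).neg.cexp
  exact h1.mul (hf.comp hL)

lemma gram_symm (hH : IsPosDefHermitian H) (j k : Fin r) : gram H ω j k = gram H ω k j := by
  change (H (ω j : Fin g → ℂ) (ω k : Fin g → ℂ)).re = (H (ω k : Fin g → ℂ) (ω j : Fin g → ℂ)).re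
  rw [← hH.conj_symm, conj_re]

/-- The automorphy factor `e^{ν H(u + γ/2, γ)}` is the coboundary of `e^{(ν/2) B(z, z)}`. -/
lemma exp_bilin_add_int (hH : IsPosDefHermitian H) (hΓ : IsIsotropic H Γ)
    (hη : ∀ j k, H (η j) (η k) = if j = k then 1 else 0)
    (hηω : ∀ k j, H (η k) (ω j : Fin g → ℂ) = 0) (p : (Fin r → ℂ) × (Fin (g - r) → ℂ)) (γ : Γ) :
    exp (ν / 2 * bilin (gram H ω) (p.1 + fun j => (ω.repr γ j : ℂ))
        (p.1 + fun j => (ω.repr γ j : ℂ)))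
      = exp (ν * H (coord ω η p + (1 / 2 : ℂ) • (γ : Fin g → ℂ)) γ) *
        exp (ν / 2 * bilin (gram H ω) p.1 p.1) := by
  rw [← Complex.exp_add]
  congr 1
  have h : coord ω η p + (1 / 2 : ℂ) • (γ : Fin g → ℂ)
      = coord ω η (p + (1 / 2 : ℂ) • ((fun j => (ω.repr γ j : ℂ)), 0)) := by
    rw [coord_add, ← coord_repr ω η γ]
    exact congrArg _ ((coordLinear ω η).map_smul _ _).symm
  have h2 : H (coord ω η p + (1 / 2 : ℂ) • (γ : Fin g → ℂ)) γ
      = ∑ j, ∑ k, (p.1 j + 1 / 2 * ω.repr γ j) * ω.repr γ k * (gram H ω j k : ℂ) := by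
    rw [h]
    conv_lhs => rw [← coord_repr ω η γ]
    rw [apply_coord hH hΓ hη hηω]
    simp
  have h3 : ∑ j, ∑ k, (ω.repr γ j : ℂ) * p.1 k * (gram H ω j k : ℂ)
      = ∑ j, ∑ k, p.1 j * (ω.repr γ k : ℂ) * (gram H ω j k : ℂ) := by
    rw [Finset.sum_comm]
    refine Finset.sum_congr rfl fun j _ => Finset.sum_congr rfl fun k _ => ?_
    rw [gram_symm hH k j]
    ring
  rw [h2]
  simp only [bilin, Pi.add_apply, add_mul, mul_add, Finset.sum_add_distrib, h3]
  have h4 : ∑ j, ∑ k, 1 / 2 * (ω.repr γ j : ℂ) * ω.repr γ k * (gram H ω j k : ℂ)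
      = 1 / 2 * ∑ j, ∑ k, (ω.repr γ j : ℂ) * ω.repr γ k * (gram H ω j k : ℂ) := by
    simp only [Finset.mul_sum, mul_assoc]
  rw [h4]
  ring

/-- A holomorphic function satisfies the functional equation if and only if its trivialisation is
quasi-periodic. -/
lemma isQuasiPeriodic_reduced_iff (hH : IsPosDefHermitian H) (hΓ : IsIsotropic H Γ)
    (hη : ∀ j k, H (η j) (η k) = if j = k then 1 else 0)
    (hηω : ∀ k j, H (η k) (ω j : Fin g → ℂ) = 0) (hbij : Function.Bijective (coord ω η))
    {χ : Γ → Circle} {α : Fin r → ℝ}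
    (hχ : ∀ γ : Γ, (χ γ : ℂ) = exp (2 * Real.pi * I * ∑ j, (α j : ℂ) * (ω.repr γ j : ℂ)))
    {f : (Fin g → ℂ) → ℂ} (hf : Differentiable ℂ f) :
    (∀ (u : Fin g → ℂ) (γ : Γ), f (u + γ) =
      (χ γ : ℂ) * exp (ν * H (u + (1 / 2 : ℂ) • (γ : Fin g → ℂ)) γ) * f u) ↔
    IsQuasiPeriodic α (reduced ν H ω η f) := by
  have hshift : ∀ (p : (Fin r → ℂ) × (Fin (g - r) → ℂ)) (γ : Γ), coord ω η p + γ
      = coord ω η (p + ((fun j => (ω.repr γ j : ℂ)), 0)) := fun p γ => by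
    rw [coord_add, coord_repr]
  have key : ∀ (p : (Fin r → ℂ) × (Fin (g - r) → ℂ)) (γ : Γ), f (coord ω η p + γ)
      = exp (ν * H (coord ω η p + (1 / 2 : ℂ) • (γ : Fin g → ℂ)) γ) *
        exp (ν / 2 * bilin (gram H ω) p.1 p.1) *
        reduced ν H ω η f (p + ((fun j => (ω.repr γ j : ℂ)), 0)) := fun p γ => by
    rw [hshift, coord_eq_exp_mul_reduced (ν := ν) (H := H) f, ← exp_bilin_add_int hH hΓ hη hηω p γ]
    rfl
  constructor
  · intro h
    refine ⟨differentiable_reduced hbij hf, fun p n => ?_⟩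
    have hn : ∀ j, ω.repr (ω.equivFun.symm n) j = n j := fun j => by
      rw [← ω.equivFun_apply, LinearEquiv.apply_symm_apply]
    have h1 := key p (ω.equivFun.symm n)
    rw [h, hχ, coord_eq_exp_mul_reduced (ν := ν) (H := H) f p] at h1
    simp only [hn] at h1
    have he1 := exp_ne_zero (ν * H (coord ω η p + (1 / 2 : ℂ) •
      ((ω.equivFun.symm n : Γ) : Fin g → ℂ)) (ω.equivFun.symm n : Γ))
    have he2 := exp_ne_zero (ν / 2 * bilin (gram H ω) p.1 p.1)
    refine mul_left_cancel₀ (mul_ne_zero he1 he2) ?_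
    rw [← h1]
    ring
  · intro h u γ
    obtain ⟨p, rfl⟩ := hbij.2 u
    rw [key, h.add_int, hχ, coord_eq_exp_mul_reduced (ν := ν) (H := H) f p]
    ring

/-- The weight `e^{-ν H(u, u)}` on a hermitian product, in terms of the trivialisations. -/
lemma conj_mul_mul_weight (hH : IsPosDefHermitian H) (hΓ : IsIsotropic H Γ)
    (hη : ∀ j k, H (η j) (η k) = if j = k then 1 else 0)
    (hηω : ∀ k j, H (η k) (ω j : Fin g → ℂ) = 0) (f h : (Fin g → ℂ) → ℂ)
    (p : (Fin r → ℂ) × (Fin (g - r) → ℂ)) :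
    starRingEnd ℂ (f (coord ω η p)) * h (coord ω η p) *
        (Real.exp (-ν * (H (coord ω η p) (coord ω η p)).re) : ℂ)
      = starRingEnd ℂ (reduced ν H ω η f p) * reduced ν H ω η h p *
        ((Real.exp (-(2 * ν) * ((fun j => (p.1 j).im) ⬝ᵥ gram H ω *ᵥ fun j => (p.1 j).im)) *
          gaussWeight ν p.2 : ℝ) : ℂ) := by
  have hre : (bilin (gram H ω) p.1 p.1).re
      = (fun j => (p.1 j).re) ⬝ᵥ gram H ω *ᵥ (fun j => (p.1 j).re)
        - (fun j => (p.1 j).im) ⬝ᵥ gram H ω *ᵥ (fun j => (p.1 j).im) := by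
    simp only [bilin, dotProduct, mulVec, Finset.mul_sum]
    rw [← Finset.sum_sub_distrib, re_sum]
    refine Finset.sum_congr rfl fun j _ => ?_
    rw [← Finset.sum_sub_distrib, re_sum]
    refine Finset.sum_congr rfl fun k _ => ?_
    rw [re_mul_ofReal, mul_re]
    ring
  have hee : starRingEnd ℂ (exp (ν / 2 * bilin (gram H ω) p.1 p.1)) *
      exp (ν / 2 * bilin (gram H ω) p.1 p.1)
      = (Real.exp (ν * (bilin (gram H ω) p.1 p.1).re) : ℂ) := by
    rw [mul_comm, Complex.mul_conj, Complex.normSq_eq_norm_sq, Complex.norm_exp,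
      ← Real.exp_nat_mul]
    congr 2
    rw [show (ν / 2 : ℂ) = ((ν / 2 : ℝ) : ℂ) by push_cast; rfl, re_ofReal_mul]
    push_cast
    ring
  rw [coord_eq_exp_mul_reduced (ν := ν) (H := H) f p, coord_eq_exp_mul_reduced (ν := ν) (H := H) h p,
    map_mul]
  have hw : (Real.exp (ν * (bilin (gram H ω) p.1 p.1).re) : ℂ) *
      (Real.exp (-ν * (H (coord ω η p) (coord ω η p)).re) : ℂ)
      = ((Real.exp (-(2 * ν) * ((fun j => (p.1 j).im) ⬝ᵥ gram H ω *ᵥ fun j => (p.1 j).im)) *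
          gaussWeight ν p.2 : ℝ) : ℂ) := by
    rw [← ofReal_mul, ← Real.exp_add, gaussWeight, ← Real.exp_add, hre,
      apply_coord_self_re hH hΓ hη hηω]
    congr 2
    ring
  rw [← hw, ← hee]
  ring

end Reduction

/-! ### The weighted scalar product in coordinates -/

section Transfer

open Matrix
open scoped InnerProductSpace

variable {g r : ℕ} {H : SesqForm g} {Γ : AddSubgroup (Fin g → ℂ)} {ω : Module.Basis (Fin r) ℤ Γ}
  {η : Fin (g - r) → Fin g → ℂ} {ν : ℝ} {α : Fin r → ℝ} {D : Set (Fin g → ℂ)}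

lemma continuous_hermitian_self (H : SesqForm g) : Continuous fun u => H u u := by
  have h : (fun u : Fin g → ℂ => H u u)
      = fun u => ∑ j, starRingEnd ℂ (u j) * H.flip (Pi.single j 1) u := by
    funext u
    have : H u u = H u (∑ j, u j • Pi.single j (1 : ℂ)) := by
      congr 1
      exact pi_eq_sum_univ' u
    rw [this, map_sum]
    refine Finset.sum_congr rfl fun j _ => ?_
    rw [LinearMap.map_smulₛₗ, smul_eq_mul, LinearMap.flip_apply]
  rw [h]
  refine continuous_finsetSum _ fun j _ => ?_
  exact (continuous_conj.comp (continuous_apply j)).mul (LinearMap.continuous_of_finiteDimensional _)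

/-- The weight `e^{-ν H(u, u)}` in terms of trivialisations, see `conj_mul_mul_weight`. -/
noncomputable def cubeWeight {d e : Type*} [Fintype d] [Fintype e] (ν : ℝ) (B : Matrix d d ℝ)
    (q : ((d → ℝ) × (d → ℝ)) × (e → ℂ)) : ℝ :=
  Real.exp (-(2 * ν) * (q.1.2 ⬝ᵥ B *ᵥ q.1.2)) * gaussWeight ν q.2

lemma conj_mul_mul_weight_realCoord (hH : IsPosDefHermitian H) (hΓ : IsIsotropic H Γ)
    (hη : ∀ j k, H (η j) (η k) = if j = k then 1 else 0)
    (hηω : ∀ k j, H (η k) (ω j : Fin g → ℂ) = 0) (f h : (Fin g → ℂ) → ℂ)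
    (q : ((Fin r → ℝ) × (Fin r → ℝ)) × (Fin (g - r) → ℂ)) :
    starRingEnd ℂ (f (coord ω η (realCoord q))) * h (coord ω η (realCoord q)) *
        (Real.exp (-ν * (H (coord ω η (realCoord q)) (coord ω η (realCoord q))).re) : ℂ)
      = starRingEnd ℂ (reduced ν H ω η f (realCoord q)) * reduced ν H ω η h (realCoord q) *
        (cubeWeight ν (gram H ω) q : ℂ) := by
  rw [conj_mul_mul_weight hH hΓ hη hηω, cubeWeight]
  simp [realCoord]

/-- The weighted product of two quasi-periodic functions is `Γ`-invariant. -/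
lemma conj_mul_mul_weight_add (hH : IsPosDefHermitian H) (hΓ : IsIsotropic H Γ)
    (hη : ∀ j k, H (η j) (η k) = if j = k then 1 else 0)
    (hηω : ∀ k j, H (η k) (ω j : Fin g → ℂ) = 0) (hbij : Function.Bijective (coord ω η))
    {f h : (Fin g → ℂ) → ℂ} (hf : IsQuasiPeriodic α (reduced ν H ω η f))
    (hh : IsQuasiPeriodic α (reduced ν H ω η h)) (γ : Γ) (u : Fin g → ℂ) :
    starRingEnd ℂ (f (u + γ)) * h (u + γ) * (Real.exp (-ν * (H (u + γ) (u + γ)).re) : ℂ)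
      = starRingEnd ℂ (f u) * h u * (Real.exp (-ν * (H u u).re) : ℂ) := by
  obtain ⟨p, rfl⟩ := hbij.2 u
  have hshift : coord ω η p + γ = coord ω η (p + ((fun j => (ω.repr γ j : ℂ)), 0)) := by
    rw [coord_add, coord_repr]
  have hunit : starRingEnd ℂ (exp (2 * Real.pi * I * ∑ j, (α j : ℂ) * (ω.repr γ j : ℂ))) *
      exp (2 * Real.pi * I * ∑ j, (α j : ℂ) * (ω.repr γ j : ℂ)) = 1 := by
    have : (2 * Real.pi * I * ∑ j, (α j : ℂ) * (ω.repr γ j : ℂ))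
        = ((2 * Real.pi * ∑ j, α j * (ω.repr γ j : ℝ) : ℝ) : ℂ) * I := by push_cast; ring
    rw [this, Complex.conj_mul', Complex.norm_exp_ofReal_mul_I]
    simp
  rw [hshift, conj_mul_mul_weight hH hΓ hη hηω, conj_mul_mul_weight hH hΓ hη hηω, hf.add_int,
    hh.add_int, map_mul]
  simp only [Prod.fst_add, Prod.snd_add, Pi.add_apply, add_im, intCast_im, add_zero]
  linear_combination (starRingEnd ℂ (reduced ν H ω η f p) * reduced ν H ω η h p *
    ((Real.exp (-(2 * ν) * ((fun j => (p.1 j).im) ⬝ᵥ gram H ω *ᵥ fun j => (p.1 j).im)) *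
      gaussWeight ν p.2 : ℝ) : ℂ)) * hunit

lemma measurable_gaussianDensity (ν : ℝ) (H : SesqForm g) :
    Measurable fun u => ENNReal.ofReal (Real.exp (-ν * (H u u).re)) :=
  (Real.continuous_exp.comp (continuous_const.mul
    (continuous_re.comp (continuous_hermitian_self H)))).measurable.ennreal_ofReal

/-- Scalar products of theta functions, computed in coordinates. -/
lemma integral_gaussianMeasure (hH : IsPosDefHermitian H) (hΓ : IsIsotropic H Γ)
    (hη : ∀ j k, H (η j) (η k) = if j = k then 1 else 0)
    (hηω : ∀ k j, H (η k) (ω j : Fin g → ℂ) = 0) (hbij : Function.Bijective (coord ω η))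
    (hD : IsAddFundamentalDomain Γ D (lebesgue ω η))
    {f h : (Fin g → ℂ) → ℂ} (hf : IsQuasiPeriodic α (reduced ν H ω η f))
    (hh : IsQuasiPeriodic α (reduced ν H ω η h)) :
    ∫ u, starRingEnd ℂ (f u) * h u ∂(gaussianMeasure ν H (lebesgue ω η) D)
      = ∫ q, starRingEnd ℂ (reduced ν H ω η f (realCoord q)) * reduced ν H ω η h (realCoord q) *
        (cubeWeight ν (gram H ω) q : ℂ) ∂(cubeMeasure (Fin r) (Fin (g - r))) := by
  have h1 := setIntegral_fundamentalDomain hbij hD (f := fun u =>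
      starRingEnd ℂ (f u) * h u * (Real.exp (-ν * (H u u).re) : ℂ))
    (conj_mul_mul_weight_add hH hΓ hη hηω hbij hf hh)
  simp only [conj_mul_mul_weight_realCoord hH hΓ hη hηω] at h1
  rw [← h1, gaussianMeasure, integral_withDensity_eq_integral_toReal_smul
    (measurable_gaussianDensity ν H) (Eventually.of_forall fun _ => ENNReal.ofReal_lt_top)]
  refine integral_congr_ae (Eventually.of_forall fun u => ?_)
  simp only [ENNReal.toReal_ofReal (Real.exp_pos _).le, Complex.real_smul]
  ring

lemma integrable_gaussianMeasure_iff (hH : IsPosDefHermitian H) (hΓ : IsIsotropic H Γ)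
    (hη : ∀ j k, H (η j) (η k) = if j = k then 1 else 0)
    (hηω : ∀ k j, H (η k) (ω j : Fin g → ℂ) = 0) (hbij : Function.Bijective (coord ω η))
    (hD : IsAddFundamentalDomain Γ D (lebesgue ω η))
    {f h : (Fin g → ℂ) → ℂ} (hf : IsQuasiPeriodic α (reduced ν H ω η f))
    (hh : IsQuasiPeriodic α (reduced ν H ω η h)) :
    Integrable (fun u => starRingEnd ℂ (f u) * h u) (gaussianMeasure ν H (lebesgue ω η) D) ↔
      Integrable (fun q => starRingEnd ℂ (reduced ν H ω η f (realCoord q)) *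
        reduced ν H ω η h (realCoord q) * (cubeWeight ν (gram H ω) q : ℂ))
        (cubeMeasure (Fin r) (Fin (g - r))) := by
  have h1 := integrableOn_fundamentalDomain_iff hbij hD (f := fun u =>
      starRingEnd ℂ (f u) * h u * (Real.exp (-ν * (H u u).re) : ℂ))
    (conj_mul_mul_weight_add hH hΓ hη hηω hbij hf hh)
  simp only [conj_mul_mul_weight_realCoord hH hΓ hη hηω] at h1
  rw [← h1, gaussianMeasure, integrable_withDensity_iff_integrable_smul'
    (measurable_gaussianDensity ν H) (Eventually.of_forall fun _ => ENNReal.ofReal_lt_top)]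
  refine integrable_congr (Eventually.of_forall fun u => ?_)
  simp only [ENNReal.toReal_ofReal (Real.exp_pos _).le, Complex.real_smul]
  ring

/-- Square integrability as integrability of the hermitian square. -/
lemma memLp_two_iff_integrable_conj_mul {X : Type*} [MeasurableSpace X] {μ : Measure X}
    {f : X → ℂ} (hf : AEStronglyMeasurable f μ) :
    MemLp f 2 μ ↔ Integrable (fun x => starRingEnd ℂ (f x) * f x) μ := by
  rw [memLp_two_iff_integrable_sq_norm hf]
  simp only [Complex.conj_mul']
  refine ⟨fun h => ?_, fun h => ?_⟩
  · simpa using h.ofReal (𝕜 := ℂ)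
  · have := h.re
    simpa [← ofReal_pow] using this

lemma integrable_conj_mul {X : Type*} [MeasurableSpace X] {μ : Measure X} {f h : X → ℂ}
    (hf : MemLp f 2 μ) (hh : MemLp h 2 μ) : Integrable (fun x => starRingEnd ℂ (f x) * h x) μ :=
  hf.star.integrable_mul hh

/-- Summation in `L²` of a pointwise convergent series. -/
lemma memLp_and_hasSum_integral {X ι : Type*} [MeasurableSpace X] {μ : Measure X} [Countable ι]
    {φ : ι → X → ℂ} (hφ : ∀ n, MemLp (φ n) 2 μ) {c : ι → ℝ} (hc : ∀ n, 0 ≤ c n)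
    (hcs : Summable c) (hnorm : ∀ n, ∫ x, starRingEnd ℂ (φ n x) * φ n x ∂μ = ((c n ^ 2 : ℝ) : ℂ))
    {F : X → ℂ} (hF : ∀ x, HasSum (fun n => φ n x) (F x)) :
    MemLp F 2 μ ∧ ∀ f, MemLp f 2 μ →
      HasSum (fun n => ∫ x, starRingEnd ℂ (φ n x) * f x ∂μ) (∫ x, starRingEnd ℂ (F x) * f x ∂μ) := by
  have hin : ∀ {a b : X → ℂ} (ha : MemLp a 2 μ) (hb : MemLp b 2 μ),
      ⟪ha.toLp a, hb.toLp b⟫_ℂ = ∫ x, starRingEnd ℂ (a x) * b x ∂μ := by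
    intro a b ha hb
    rw [L2.inner_def]
    refine integral_congr_ae ?_
    filter_upwards [ha.coeFn_toLp, hb.coeFn_toLp] with x h1 h2
    rw [h1, h2, RCLike.inner_apply, mul_comm]
  have hn : ∀ n, ‖(hφ n).toLp (φ n)‖ = c n := by
    intro n
    have h1 := inner_self_eq_norm_sq_to_K (𝕜 := ℂ) ((hφ n).toLp (φ n))
    rw [hin, hnorm] at h1
    have h2 : c n ^ 2 = ‖(hφ n).toLp (φ n)‖ ^ 2 := by
      apply Complex.ofReal_injective
      rw [h1]
      push_cast
      rfl
    exact ((pow_left_inj₀ (hc n) (norm_nonneg _) two_ne_zero).1 h2).symm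
  have hs : Summable fun n => (hφ n).toLp (φ n) :=
    Summable.of_norm (hcs.congr fun n => (hn n).symm)
  obtain ⟨G, hG⟩ := hs
  have hGF : G =ᵐ[μ] F := by
    refine ae_eq_of_tendsto_Lp hG (v := fun s x => ∑ n ∈ s, φ n x) (fun s => ?_) hF
    have h1 := (Lp.coeFn_finsetSum s fun n => (hφ n).toLp (φ n))
    have h2 : ∀ᵐ x ∂μ, ∀ n, (hφ n).toLp (φ n) x = φ n x :=
      ae_all_iff.2 fun n => (hφ n).coeFn_toLp
    filter_upwards [h1, h2] with x hx hx2
    rw [hx]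
    simp [hx2]
  have hFm : MemLp F 2 μ := (memLp_congr_ae hGF).1 (Lp.memLp G)
  have hGe : G = hFm.toLp F := by
    rw [← Lp.toLp_coeFn G (Lp.memLp G)]
    exact (MemLp.toLp_eq_toLp_iff _ _).2 hGF
  refine ⟨hFm, fun f hf => ?_⟩
  have h1 := ((innerSL ℂ (hf.toLp f)).hasSum hG).map (starRingEnd ℂ) continuous_conj
  rw [hGe] at h1
  simp only [Function.comp_def, innerSL_apply_apply, inner_conj_symm] at h1
  simpa only [hin] using h1

end Transfer

/-! ### Products of characters and Fock kernels -/

section Basis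

open Matrix
open scoped InnerProductSpace

variable {g r : ℕ} {H : SesqForm g} {Γ : AddSubgroup (Fin g → ℂ)} {ω : Module.Basis (Fin r) ℤ Γ}
  {η : Fin (g - r) → Fin g → ℂ} {ν : ℝ} {α : Fin r → ℝ} {D : Set (Fin g → ℂ)}

/-- The theta function with trivialisation `e^{2πi (α + n)·z} e^{ν z_⊥ · \bar w}`. -/
noncomputable def fourierFock (ν : ℝ) (H : SesqForm g) (hbij : Function.Bijective (coord ω η))
    (α : Fin r → ℝ) (n : Fin r → ℤ) (w : Fin (g - r) → ℂ) : (Fin g → ℂ) → ℂ :=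
  unreduced ν H hbij fun p => character α n p.1 * fockKernel ν p.2 w

lemma reduced_fourierFock (hbij : Function.Bijective (coord ω η)) (n : Fin r → ℤ)
    (w : Fin (g - r) → ℂ) : reduced ν H ω η (fourierFock ν H hbij α n w)
      = fun p => character α n p.1 * fockKernel ν p.2 w :=
  reduced_unreduced hbij _

lemma isQuasiPeriodic_character_mul_fockKernel {d e : Type*} [Fintype d] [Fintype e] (ν : ℝ)
    (α : d → ℝ) (n : d → ℤ) (w : e → ℂ) :
    IsQuasiPeriodic α fun p : (d → ℂ) × (e → ℂ) => character α n p.1 * fockKernel ν p.2 w where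
  differentiable := ((differentiable_character α n).comp differentiable_fst).mul
    ((differentiable_fockKernel ν w).comp differentiable_snd)
  add_int p m := by
    simp only [Prod.fst_add, Prod.snd_add, add_zero, character_add_int]
    ring

lemma conj_fockKernel {e : Type*} [Fintype e] (ν : ℝ) (z w : e → ℂ) :
    starRingEnd ℂ (fockKernel ν z w) = fockKernel ν w z := by
  rw [fockKernel, fockKernel, ← Complex.exp_conj]
  simp [mul_comm]

lemma conj_character_realCoord_mul_cubeWeight {d e : Type*} [Fintype d] [Fintype e] (ν : ℝ)
    (B : Matrix d d ℝ) (α : d → ℝ) (n : d → ℤ) (q : ((d → ℝ) × (d → ℝ)) × (e → ℂ)) :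
    starRingEnd ℂ (character α n (realCoord q).1) * (cubeWeight ν B q : ℂ)
      = (character α n (realCoord q).1)⁻¹ * (gaussWeight ν q.2 : ℂ) *
        (fibreDensity ν B α n q.1.2 : ℂ) := by
  rw [conj_character, cubeWeight, fibreDensity]
  simp only [realCoord, add_im, ofReal_im, mul_im, ofReal_re, I_im, I_re, mul_one, mul_zero,
    zero_add, add_zero]
  push_cast
  ring

lemma differentiable_fourierFock (hbij : Function.Bijective (coord ω η)) (n : Fin r → ℤ)
    (w : Fin (g - r) → ℂ) : Differentiable ℂ (fourierFock ν H hbij α n w) :=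
  differentiable_unreduced hbij (isQuasiPeriodic_character_mul_fockKernel ν α n w).differentiable

lemma conj_mul_self_cubeWeight {d e : Type*} [Fintype d] [Fintype e] (ν : ℝ)
    (B : Matrix d d ℝ) (α : d → ℝ) (n : d → ℤ) (w : e → ℂ)
    (q : ((d → ℝ) × (d → ℝ)) × (e → ℂ)) :
    starRingEnd ℂ (character α n (realCoord q).1 * fockKernel ν (realCoord q).2 w) *
      (character α n (realCoord q).1 * fockKernel ν (realCoord q).2 w) * (cubeWeight ν B q : ℂ)
      = ((fibreDensity ν B α n q.1.2 * (‖fockKernel ν q.2 w‖ ^ 2 * gaussWeight ν q.2) : ℝ) : ℂ) := by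
  have h1 := conj_character_realCoord_mul_cubeWeight ν B α n q
  have h2 := Complex.conj_mul' (fockKernel ν (realCoord q).2 w)
  have h3 := inv_mul_cancel₀ (character_ne_zero α n (realCoord q).1)
  rw [show (realCoord q).2 = q.2 from rfl] at *
  rw [map_mul]
  push_cast
  rw [← h2]
  linear_combination (starRingEnd ℂ (fockKernel ν q.2 w) * character α n (realCoord q).1 *
    fockKernel ν q.2 w) * h1 + (starRingEnd ℂ (fockKernel ν q.2 w) *
    fockKernel ν q.2 w * (gaussWeight ν q.2 : ℂ) * (fibreDensity ν B α n q.1.2 : ℂ)) * h3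

/-- Square integrability and the squared norm of `fourierFock`. -/
lemma memLp_and_integral_fourierFock (hH : IsPosDefHermitian H) (hν : 0 < ν)
    (hΓ : IsIsotropic H Γ) (hη : ∀ j k, H (η j) (η k) = if j = k then 1 else 0)
    (hηω : ∀ k j, H (η k) (ω j : Fin g → ℂ) = 0) (hB : (gram H ω).PosDef)
    (hbij : Function.Bijective (coord ω η)) (hD : IsAddFundamentalDomain Γ D (lebesgue ω η))
    (n : Fin r → ℤ) (w : Fin (g - r) → ℂ) :
    MemLp (fourierFock ν H hbij α n w) 2 (gaussianMeasure ν H (lebesgue ω η) D) ∧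
    ∫ u, starRingEnd ℂ (fourierFock ν H hbij α n w u) * fourierFock ν H hbij α n w u
      ∂(gaussianMeasure ν H (lebesgue ω η) D)
      = ((volume.real (unitBox (Fin r)) * gaussConst ν (gram H ω) α n *
        ∫ ζ : Fin (g - r) → ℂ, ‖fockKernel ν ζ w‖ ^ 2 * gaussWeight ν ζ : ℝ) : ℂ) := by
  obtain ⟨h1, h2⟩ := integrable_and_integral_cubeMeasure hν hB α n w
  have hq : IsQuasiPeriodic α (reduced ν H ω η (fourierFock ν H hbij α n w)) := by
    rw [reduced_fourierFock]
    exact isQuasiPeriodic_character_mul_fockKernel ν α n w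
  constructor
  · rw [memLp_two_iff_integrable_conj_mul
      (differentiable_fourierFock hbij n w).continuous.aestronglyMeasurable,
      integrable_gaussianMeasure_iff hH hΓ hη hηω hbij hD hq hq, reduced_fourierFock]
    simp only [conj_mul_self_cubeWeight]
    exact h1.ofReal
  · rw [integral_gaussianMeasure hH hΓ hη hηω hbij hD hq hq, reduced_fourierFock]
    simp only [conj_mul_self_cubeWeight]
    rw [← h2]
    exact integral_ofReal

/-- The scalar products of a theta function with the `fourierFock` functions are, up to known factors,
the Fourier coefficients of its trivialisation. -/
lemma integral_conj_fourierFock_mul (hH : IsPosDefHermitian H) (hν : 0 < ν)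
    (hΓ : IsIsotropic H Γ) (hη : ∀ j k, H (η j) (η k) = if j = k then 1 else 0)
    (hηω : ∀ k j, H (η k) (ω j : Fin g → ℂ) = 0) (hB : (gram H ω).PosDef)
    (hbij : Function.Bijective (coord ω η)) (hD : IsAddFundamentalDomain Γ D (lebesgue ω η))
    {f : (Fin g → ℂ) → ℂ} (hf : IsQuasiPeriodic α (reduced ν H ω η f))
    (hfL : MemLp f 2 (gaussianMeasure ν H (lebesgue ω η) D)) (n : Fin r → ℤ)
    (w : Fin (g - r) → ℂ) :
    ∫ u, starRingEnd ℂ (fourierFock ν H hbij α n w u) * f u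
      ∂(gaussianMeasure ν H (lebesgue ω η) D)
      = (((Real.pi / ν) ^ (g - r) * gaussConst ν (gram H ω) α n : ℝ) : ℂ) *
        fourierCoefficient α (reduced ν H ω η f) n w := by
  have hq : IsQuasiPeriodic α (reduced ν H ω η (fourierFock ν H hbij α n w)) := by
    rw [reduced_fourierFock]
    exact isQuasiPeriodic_character_mul_fockKernel ν α n w
  have hint := (integrable_gaussianMeasure_iff hH hΓ hη hηω hbij hD hq hf).1 (integrable_conj_mul
    (memLp_and_integral_fourierFock hH hν hΓ hη hηω hB hbij hD n w).1 hfL)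
  have hpt : (fun q => starRingEnd ℂ (reduced ν H ω η (fourierFock ν H hbij α n w) (realCoord q)) *
      reduced ν H ω η f (realCoord q) * (cubeWeight ν (gram H ω) q : ℂ))
      = fun q => reduced ν H ω η f (realCoord q) * (character α n (realCoord q).1)⁻¹ *
        fockKernel ν w q.2 * (gaussWeight ν q.2 : ℂ) *
        (fibreDensity ν (gram H ω) α n q.1.2 : ℂ) := by
    funext q
    rw [reduced_fourierFock, map_mul, conj_fockKernel]
    have h1 := conj_character_realCoord_mul_cubeWeight ν (gram H ω) α n q
    rw [show (realCoord q).2 = q.2 from rfl]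
    linear_combination (fockKernel ν w q.2 * reduced ν H ω η f (realCoord q)) * h1
  rw [hpt] at hint
  rw [integral_gaussianMeasure hH hΓ hη hηω hbij hD hq hf, hpt,
    hf.integral_cubeMeasure hν hB n w hint, Fintype.card_fin]
  push_cast
  ring

end Basis

/-! ### The reproducing kernel -/

section ReproducingKernel

open Matrix

variable {g r : ℕ} {H : SesqForm g} {Γ : AddSubgroup (Fin g → ℂ)} {ω : Module.Basis (Fin r) ℤ Γ}
  {η : Fin (g - r) → Fin g → ℂ} {ν : ℝ} {α : Fin r → ℝ} {D : Set (Fin g → ℂ)}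

/-- The normalising constant of the reproducing kernel. -/
noncomputable def kernelConst {r : ℕ} (ν : ℝ) (B : Matrix (Fin r) (Fin r) ℝ) (m : ℕ) : ℝ :=
  √B.det * (2 * ν / Real.pi) ^ ((r : ℝ) / 2) * (ν / Real.pi) ^ m

lemma kernelConst_mul_dualGauss {B : Matrix (Fin r) (Fin r) ℝ} (hν : 0 < ν) (hB : B.PosDef)
    (m : ℕ) (n : Fin r → ℤ) :
    kernelConst ν B m * dualGauss (2 * Real.pi ^ 2 / ν) B α n *
      ((Real.pi / ν) ^ m * gaussConst ν B α n) = 1 := by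
  have h1 : (ν / Real.pi) ^ m * (Real.pi / ν) ^ m = 1 := by
    rw [← mul_pow, div_mul_div_cancel₀ Real.pi_ne_zero, div_self hν.ne', one_pow]
  have h2 : (2 * ν / Real.pi) ^ ((r : ℝ) / 2) * (Real.pi / (2 * ν)) ^ ((r : ℝ) / 2) = 1 := by
    rw [← Real.mul_rpow (by positivity) (by positivity), div_mul_div_cancel₀ Real.pi_ne_zero,
      div_self (by positivity), Real.one_rpow]
  have h3 : √B.det ≠ 0 := (Real.sqrt_pos.2 hB.det_pos).ne'
  have h4 := (dualGauss_pos (2 * Real.pi ^ 2 / ν) B α n).ne'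
  rw [kernelConst, gaussConst_eq]
  field_simp
  linear_combination (2 * ν / Real.pi) ^ ((r : ℝ) / 2) * (Real.pi / (2 * ν)) ^ ((r : ℝ) / 2) * h1 + h2

/-- The reproducing kernel with second argument `coord ω η p`. -/
noncomputable def thetaKernel (ν : ℝ) (H : SesqForm g) (hbij : Function.Bijective (coord ω η))
    (α : Fin r → ℝ) (p : (Fin r → ℂ) × (Fin (g - r) → ℂ)) : (Fin g → ℂ) → ℂ :=
  unreduced ν H hbij fun q => (kernelConst ν (gram H ω) (g - r) : ℂ) *
    exp (ν / 2 * starRingEnd ℂ (bilin (gram H ω) p.1 p.1)) *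
    theta α 0 (fun j => q.1 j - starRingEnd ℂ (p.1 j)) (periodMatrix ν (gram H ω)) *
    fockKernel ν q.2 p.2

lemma isQuasiPeriodic_reduced_thetaKernel (hν : 0 < ν) (hB : (gram H ω).PosDef)
    (hbij : Function.Bijective (coord ω η)) (p : (Fin r → ℂ) × (Fin (g - r) → ℂ)) :
    IsQuasiPeriodic α (reduced ν H ω η (thetaKernel ν H hbij α p)) := by
  rw [thetaKernel, reduced_unreduced]
  constructor
  · have h1 : Differentiable ℂ fun q : (Fin r → ℂ) × (Fin (g - r) → ℂ) =>
        theta α 0 (fun j => q.1 j - starRingEnd ℂ (p.1 j)) (periodMatrix ν (gram H ω)) := by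
      refine (differentiable_theta hν hB α).comp
        (g := fun z => theta α 0 z (periodMatrix ν (gram H ω)))
        (f := fun (q : (Fin r → ℂ) × (Fin (g - r) → ℂ)) j => q.1 j - starRingEnd ℂ (p.1 j)) ?_
      fun_prop
    exact (h1.const_mul _).mul ((differentiable_fockKernel ν p.2).comp differentiable_snd)
  · intro q m
    have h1 := theta_add_int ν (gram H ω) α (fun j => q.1 j - starRingEnd ℂ (p.1 j)) m
    have h2 : (fun j => (q + ((fun j => (m j : ℂ)), 0)).1 j - starRingEnd ℂ (p.1 j))
        = (fun j => q.1 j - starRingEnd ℂ (p.1 j)) + fun j => (m j : ℂ) := by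
      funext j
      simp only [Prod.fst_add, Pi.add_apply]
      ring
    rw [h2, h1]
    simp only [Prod.snd_add, add_zero]
    ring

lemma differentiable_thetaKernel (hν : 0 < ν) (hB : (gram H ω).PosDef)
    (hbij : Function.Bijective (coord ω η)) (p : (Fin r → ℂ) × (Fin (g - r) → ℂ)) :
    Differentiable ℂ (thetaKernel ν H hbij α p) := by
  have h1 := (isQuasiPeriodic_reduced_thetaKernel (α := α) hν hB hbij p).differentiable
  rw [thetaKernel, reduced_unreduced] at h1
  exact differentiable_unreduced hbij h1

lemma character_sub_conj {d : Type*} [Fintype d] (α : d → ℝ) (n : d → ℤ) (z w : d → ℂ) :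
    character α n (fun j => z j - starRingEnd ℂ (w j))
      = character α n z * starRingEnd ℂ (character α n w) := by
  rw [character, character, character, ← Complex.exp_conj, ← Complex.exp_add]
  congr 1
  simp only [map_mul, map_sum, map_add, conj_ofReal, map_intCast, conj_I, map_ofNat, mul_sub,
    Finset.sum_sub_distrib]
  ring

/-- The coefficients of the kernel in the functions `fourierFock`. -/
noncomputable def kernelCoeff {r : ℕ} (ν : ℝ) (B : Matrix (Fin r) (Fin r) ℝ) (m : ℕ)
    (α : Fin r → ℝ) (w : Fin r → ℂ) (n : Fin r → ℤ) : ℂ :=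
  exp (ν / 2 * starRingEnd ℂ (bilin B w w)) * starRingEnd ℂ (character α n w) *
    ((kernelConst ν B m * dualGauss (2 * Real.pi ^ 2 / ν) B α n : ℝ) : ℂ)

lemma hasSum_thetaKernel (hν : 0 < ν) (hB : (gram H ω).PosDef)
    (hbij : Function.Bijective (coord ω η)) (p : (Fin r → ℂ) × (Fin (g - r) → ℂ))
    (u : Fin g → ℂ) :
    HasSum (fun n => kernelCoeff ν (gram H ω) (g - r) α p.1 n * fourierFock ν H hbij α n p.2 u)
      (thetaKernel ν H hbij α p u) := by
  obtain ⟨q, rfl⟩ := hbij.2 u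
  rw [thetaKernel, unreduced_coord]
  have h1 := (summable_thetaTerm hν hB α fun j => q.1 j - starRingEnd ℂ (p.1 j)).hasSum
  have h2 := (h1.mul_left (exp (ν / 2 * bilin (gram H ω) q.1 q.1) *
    (kernelConst ν (gram H ω) (g - r) : ℂ) *
    exp (ν / 2 * starRingEnd ℂ (bilin (gram H ω) p.1 p.1)))).mul_right (fockKernel ν q.2 p.2)
  rw [← theta] at h2
  have h3 : ∀ n, kernelCoeff ν (gram H ω) (g - r) α p.1 n *
      fourierFock ν H hbij α n p.2 (coord ω η q) =
      exp (ν / 2 * bilin (gram H ω) q.1 q.1) * (kernelConst ν (gram H ω) (g - r) : ℂ) *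
        exp (ν / 2 * starRingEnd ℂ (bilin (gram H ω) p.1 p.1)) *
        thetaTerm α 0 (fun j => q.1 j - starRingEnd ℂ (p.1 j)) (periodMatrix ν (gram H ω)) n *
        fockKernel ν q.2 p.2 := fun n => by
    rw [fourierFock, unreduced_coord, thetaTerm_eq, character_sub_conj, kernelCoeff]
    push_cast
    ring
  simp only [h3]
  simpa only [mul_assoc] using h2

/-- The terms of the kernel expansion are summable in norm: the square root of the Gaussian
normalisation still decays. -/
lemma memLp_thetaKernel_and_hasSum (hH : IsPosDefHermitian H) (hν : 0 < ν)
    (hΓ : IsIsotropic H Γ) (hη : ∀ j k, H (η j) (η k) = if j = k then 1 else 0)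
    (hηω : ∀ k j, H (η k) (ω j : Fin g → ℂ) = 0) (hB : (gram H ω).PosDef)
    (hbij : Function.Bijective (coord ω η)) (hD : IsAddFundamentalDomain Γ D (lebesgue ω η))
    (p : (Fin r → ℂ) × (Fin (g - r) → ℂ)) :
    MemLp (thetaKernel ν H hbij α p) 2 (gaussianMeasure ν H (lebesgue ω η) D) ∧
    ∀ f, MemLp f 2 (gaussianMeasure ν H (lebesgue ω η) D) →
      HasSum (fun n => ∫ u, starRingEnd ℂ (kernelCoeff ν (gram H ω) (g - r) α p.1 n *
          fourierFock ν H hbij α n p.2 u) * f u ∂(gaussianMeasure ν H (lebesgue ω η) D))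
        (∫ u, starRingEnd ℂ (thetaKernel ν H hbij α p u) * f u
          ∂(gaussianMeasure ν H (lebesgue ω η) D)) := by
  set W : ℝ := ∫ ζ : Fin (g - r) → ℂ, ‖fockKernel ν ζ p.2‖ ^ 2 * gaussWeight ν ζ with hW
  have hW0 : 0 ≤ W := integral_nonneg fun ζ => mul_nonneg (sq_nonneg _) (Real.exp_pos _).le
  set C : ℝ := (Real.pi / (2 * ν)) ^ ((r : ℝ) / 2) / √(gram H ω).det with hC
  have hC0 : 0 ≤ C := by positivity
  have hV0 : 0 ≤ volume.real (unitBox (Fin r)) := measureReal_nonneg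
  -- the Gaussian in the theta series is a square: one factor cancels the norm of `fourierFock`, and
  -- the other makes the norms summable
  have hd : ∀ n, dualGauss (2 * Real.pi ^ 2 / ν) (gram H ω) α n
      = dualGauss (Real.pi ^ 2 / ν) (gram H ω) α n * dualGauss (Real.pi ^ 2 / ν) (gram H ω) α n :=
    fun n => by rw [dualGauss_mul_self, mul_div_assoc]
  refine memLp_and_hasSum_integral
    (fun n => ((memLp_and_integral_fourierFock (α := α) hH hν hΓ hη hηω hB hbij hD n p.2).1.const_mul
      (kernelCoeff ν (gram H ω) (g - r) α p.1 n)))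
    (c := fun n => |kernelConst ν (gram H ω) (g - r)| *
      ‖exp (ν / 2 * starRingEnd ℂ (bilin (gram H ω) p.1 p.1))‖ *
      √(volume.real (unitBox (Fin r)) * C * W) *
      (dualGauss (Real.pi ^ 2 / ν) (gram H ω) α n * ‖character α n p.1‖))
    (fun n => by have := dualGauss_pos (Real.pi ^ 2 / ν) (gram H ω) α n; positivity)
    ((summable_dualGauss_mul_norm_character hB (by positivity) α p.1).mul_left _) (fun n => ?_)
    (hasSum_thetaKernel hν hB hbij p)
  have hpos := (dualGauss_pos (Real.pi ^ 2 / ν) (gram H ω) α n).ne'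
  have h1 : ∀ u, starRingEnd ℂ (kernelCoeff ν (gram H ω) (g - r) α p.1 n *
      fourierFock ν H hbij α n p.2 u) * (kernelCoeff ν (gram H ω) (g - r) α p.1 n *
      fourierFock ν H hbij α n p.2 u) = ((‖kernelCoeff ν (gram H ω) (g - r) α p.1 n‖ ^ 2 : ℝ) : ℂ) *
        (starRingEnd ℂ (fourierFock ν H hbij α n p.2 u) * fourierFock ν H hbij α n p.2 u) := by
    intro u
    push_cast
    rw [← Complex.conj_mul', map_mul]
    ring
  simp only [h1]
  rw [integral_const_mul, (memLp_and_integral_fourierFock hH hν hΓ hη hηω hB hbij hD n p.2).2,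
    ← ofReal_mul, ← hW, gaussConst_eq, ← hC, kernelCoeff, norm_mul, norm_mul, RCLike.norm_conj,
    norm_real, Real.norm_eq_abs, abs_mul, abs_of_pos (dualGauss_pos _ _ _ _), hd]
  congr 1
  simp only [mul_pow]
  rw [Real.sq_sqrt (by positivity)]
  field_simp

/-- The reproducing property. -/
lemma integral_conj_thetaKernel_mul (hH : IsPosDefHermitian H) (hν : 0 < ν)
    (hΓ : IsIsotropic H Γ) (hη : ∀ j k, H (η j) (η k) = if j = k then 1 else 0)
    (hηω : ∀ k j, H (η k) (ω j : Fin g → ℂ) = 0) (hB : (gram H ω).PosDef)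
    (hbij : Function.Bijective (coord ω η)) (hD : IsAddFundamentalDomain Γ D (lebesgue ω η))
    {f : (Fin g → ℂ) → ℂ} (hf : IsQuasiPeriodic α (reduced ν H ω η f))
    (hfL : MemLp f 2 (gaussianMeasure ν H (lebesgue ω η) D))
    (p : (Fin r → ℂ) × (Fin (g - r) → ℂ)) :
    ∫ u, starRingEnd ℂ (thetaKernel ν H hbij α p u) * f u
      ∂(gaussianMeasure ν H (lebesgue ω η) D) = f (coord ω η p) := by
  have h1 := (memLp_thetaKernel_and_hasSum (α := α) hH hν hΓ hη hηω hB hbij hD p).2 f hfL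
  have h2 : ∀ n, ∫ u, starRingEnd ℂ (kernelCoeff ν (gram H ω) (g - r) α p.1 n *
          fourierFock ν H hbij α n p.2 u) * f u ∂(gaussianMeasure ν H (lebesgue ω η) D)
      = exp (ν / 2 * bilin (gram H ω) p.1 p.1) *
        (fourierCoefficient α (reduced ν H ω η f) n p.2 * character α n p.1) := by
    intro n
    have h3 := congrArg (fun x : ℝ => (x : ℂ))
      (kernelConst_mul_dualGauss (α := α) hν hB (g - r) n)
    simp only [map_mul, mul_assoc]
    rw [integral_const_mul, integral_conj_fourierFock_mul hH hν hΓ hη hηω hB hbij hD hf hfL,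
      kernelCoeff]
    simp only [map_mul, conj_ofReal, Complex.conj_conj, ← Complex.exp_conj, map_div₀, map_ofNat]
    push_cast at h3 ⊢
    linear_combination exp (ν / 2 * bilin (gram H ω) p.1 p.1) *
      (fourierCoefficient α (reduced ν H ω η f) n p.2 * character α n p.1) * h3
  simp only [h2] at h1
  have hs := (summable_mul_left_iff (exp_ne_zero _)).1 h1.summable
  have h4 := (hf.hasSum p.1 p.2 hs).mul_left (exp (ν / 2 * bilin (gram H ω) p.1 p.1))
  rw [h1.unique h4, coord_eq_exp_mul_reduced (ν := ν) (H := H) f p]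

end ReproducingKernel

/-! ### The theta space -/

section ThetaSpace

open Matrix

variable {g r : ℕ} {H : SesqForm g} {Γ : AddSubgroup (Fin g → ℂ)} {ω : Module.Basis (Fin r) ℤ Γ}
  {η : Fin (g - r) → Fin g → ℂ} {ν : ℝ} {α : Fin r → ℝ} {D : Set (Fin g → ℂ)}

/-- The kernel is continuous on the diagonal. -/
lemma continuous_thetaKernel_diagonal (hν : 0 < ν) (hB : (gram H ω).PosDef)
    (hbij : Function.Bijective (coord ω η)) :
    Continuous fun u => thetaKernel ν H hbij α ((coordEquiv hbij).symm u) u := by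
  have hb : Continuous fun z : Fin r → ℂ => bilin (gram H ω) z z :=
    (differentiable_bilin _).continuous
  have ht : Continuous fun p : (Fin r → ℂ) × (Fin (g - r) → ℂ) =>
      theta α 0 (fun j => p.1 j - starRingEnd ℂ (p.1 j)) (periodMatrix ν (gram H ω)) := by
    refine (differentiable_theta hν hB α).continuous.comp
      (g := fun z => theta α 0 z (periodMatrix ν (gram H ω)))
      (f := fun (p : (Fin r → ℂ) × (Fin (g - r) → ℂ)) j => p.1 j - starRingEnd ℂ (p.1 j)) ?_
    fun_prop
  have hk : Continuous fun p : (Fin r → ℂ) × (Fin (g - r) → ℂ) =>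
      exp (ν / 2 * bilin (gram H ω) p.1 p.1) * ((kernelConst ν (gram H ω) (g - r) : ℂ) *
        exp (ν / 2 * starRingEnd ℂ (bilin (gram H ω) p.1 p.1)) *
        theta α 0 (fun j => p.1 j - starRingEnd ℂ (p.1 j)) (periodMatrix ν (gram H ω)) *
        fockKernel ν p.2 p.2) := by
    unfold fockKernel
    have := hb.comp (continuous_fst (X := Fin r → ℂ) (Y := Fin (g - r) → ℂ))
    fun_prop
  exact hk.comp (coordEquiv hbij).symm.continuous

/-- The functional equation and holomorphy pass to locally uniform limits. -/
lemma mem_thetaSpace_of_tendstoLocallyUniformly {χ : Γ → Circle} {lam : Measure (Fin g → ℂ)}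
    (u : ℕ → thetaSpace ν H Γ χ lam D) {F : (Fin g → ℂ) → ℂ}
    (hu : TendstoLocallyUniformly (fun n => (u n : (Fin g → ℂ) → ℂ)) F atTop)
    (hF : MemLp F 2 (gaussianMeasure ν H lam D)) : F ∈ thetaSpace ν H Γ χ lam D := by
  have hpt : ∀ x, Tendsto (fun n => (u n : (Fin g → ℂ) → ℂ) x) atTop (𝓝 (F x)) := fun x =>
    (tendstoLocallyUniformlyOn_univ.2 hu).tendsto_at (Set.mem_univ x)
  refine ⟨differentiable_of_tendstoLocallyUniformly (fun n => (u n).2.1) hu, fun x γ => ?_, hF⟩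
  refine tendsto_nhds_unique (hpt (x + γ)) ?_
  simp only [fun n => (u n).2.2.1 x γ]
  exact (hpt x).const_mul _

end ThetaSpace

end ThetaFock

theorem theorem2 {g r : ℕ} (H : ThetaFock.SesqForm g) (hH : ThetaFock.IsPosDefHermitian H)
    (ν : ℝ) (hν : 0 < ν)
    (Γ : AddSubgroup (Fin g → ℂ)) [DiscreteTopology Γ] (hΓ : ThetaFock.IsIsotropic H Γ)
    (ω : Module.Basis (Fin r) ℤ Γ)
    (η : Fin (g - r) → Fin g → ℂ)
    (hη : ∀ j k, H (η j) (η k) = if j = k then 1 else 0)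
    (hηω : ∀ k j, H (η k) (ω j : Fin g → ℂ) = 0)
    (χ : AddChar Γ Circle) (α : Fin r → ℝ)
    (hχ : ∀ γ : Γ, (χ γ : ℂ) =
      Complex.exp (2 * Real.pi * Complex.I * ∑ j, (α j : ℂ) * (ω.repr γ j : ℂ)))
    (D : Set (Fin g → ℂ))
    (hD : MeasureTheory.IsAddFundamentalDomain Γ D (ThetaFock.lebesgue ω η)) :
    Function.Bijective (ThetaFock.coord ω η) ∧
    (∀ z : Fin r → ℂ, Summable
      (ThetaFock.thetaTerm α 0 z (ThetaFock.periodMatrix ν (ThetaFock.gram H ω)))) ∧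
    ∃ K : (Fin g → ℂ) → (Fin g → ℂ) → ℂ,
      ThetaFock.IsRKHSWithKernel
        (ThetaFock.thetaSpace ν H Γ χ (ThetaFock.lebesgue ω η) D).subtype
        (ThetaFock.thetaInner ν H Γ χ (ThetaFock.lebesgue ω η) D) K ∧
      ∀ (z w : Fin r → ℂ) (z' w' : Fin (g - r) → ℂ),
        K (ThetaFock.coord ω η (z, z')) (ThetaFock.coord ω η (w, w')) =
          (Real.sqrt (ThetaFock.gram H ω).det : ℂ)
          * (((2 * ν / Real.pi) ^ ((r : ℝ) / 2) : ℝ) : ℂ)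
          * (((ν / Real.pi) ^ (g - r) : ℝ) : ℂ)
          * Complex.exp ((ν / 2 : ℂ) * (ThetaFock.bilin (ThetaFock.gram H ω) z z
              + starRingEnd ℂ (ThetaFock.bilin (ThetaFock.gram H ω) w w)))
          * ThetaFock.theta α 0 (fun j => z j - starRingEnd ℂ (w j))
              (ThetaFock.periodMatrix ν (ThetaFock.gram H ω))
          * Complex.exp ((ν : ℂ) * ∑ k, z' k * starRingEnd ℂ (w' k)) := by
  have hB := ThetaFock.posDef_gram (ω := ω) hH hΓ hη hηω
  have hbij := ThetaFock.coord_bijective hH hΓ hη hηω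
  refine ⟨hbij, ThetaFock.summable_thetaTerm hν hB α,
    fun x y => ThetaFock.thetaKernel ν H hbij α ((ThetaFock.coordEquiv hbij).symm y) x, ?_, ?_⟩
  · have hqp : ∀ f : ThetaFock.thetaSpace ν H Γ χ (ThetaFock.lebesgue ω η) D,
        ThetaFock.IsQuasiPeriodic α (ThetaFock.reduced ν H ω η f.1) := fun f =>
      (ThetaFock.isQuasiPeriodic_reduced_iff hH hΓ hη hηω hbij hχ f.2.1).1 f.2.2.1
    let k : (Fin g → ℂ) → ThetaFock.thetaSpace ν H Γ χ (ThetaFock.lebesgue ω η) D := fun y =>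
      ⟨ThetaFock.thetaKernel ν H hbij α ((ThetaFock.coordEquiv hbij).symm y),
        ThetaFock.differentiable_thetaKernel hν hB hbij _,
        (ThetaFock.isQuasiPeriodic_reduced_iff hH hΓ hη hηω hbij hχ
          (ThetaFock.differentiable_thetaKernel hν hB hbij _)).2
          (ThetaFock.isQuasiPeriodic_reduced_thetaKernel hν hB hbij _),
        (ThetaFock.memLp_thetaKernel_and_hasSum hH hν hΓ hη hηω hB hbij hD _).1⟩
    refine ThetaFock.isRKHSWithKernel_of_reproducing
      (μ := ThetaFock.gaussianMeasure ν H (ThetaFock.lebesgue ω η) D)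
      (ev := (ThetaFock.thetaSpace ν H Γ χ (ThetaFock.lebesgue ω η) D).subtype)
      Subtype.val_injective (fun f => f.2.2.2) (fun f h => rfl) k (fun f x => ?_) (fun x => ?_)
      (fun u F hu hF => ⟨⟨F, ThetaFock.mem_thetaSpace_of_tendstoLocallyUniformly u hu hF⟩, rfl⟩)
    · refine Eq.trans ?_ (ThetaFock.integral_conj_thetaKernel_mul hH hν hΓ hη hηω hB hbij hD
        (hqp f) f.2.2.2 ((ThetaFock.coordEquiv hbij).symm x)).symm
      exact congrArg f.1 ((ThetaFock.coordEquiv hbij).apply_symm_apply x).symm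
    · have hc := (ThetaFock.continuous_thetaKernel_diagonal (α := α) hν hB hbij).norm
      exact ⟨_, ((hc.tendsto x).eventually (gt_mem_nhds (lt_add_one _))).mono
        fun y hy => le_of_lt hy⟩
  · intro z w z' w'
    have hsymm : (ThetaFock.coordEquiv hbij).symm (ThetaFock.coord ω η (w, w')) = (w, w') :=
      (ThetaFock.coordEquiv hbij).symm_apply_apply (w, w')
    simp only [hsymm]
    rw [ThetaFock.thetaKernel, ThetaFock.unreduced_coord, ThetaFock.kernelConst,
      ThetaFock.fockKernel, mul_add, Complex.exp_add]
    push_cast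
    ring
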